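/- A \emph{convex polyhedron} is a bounded subset of $\mathbb{R}^3$ with nonempty interior that is the intersection of finitely many half-spaces. It is \emph{$k$-equiprojective} if its orthogonal projection in every direction not parallel to one of its faces is a convex polygon with exactly $k$ vertices. Let $P$ be a triangular cupola (the Johnson solid with regular faces, of any size and in any position), with top triangle $a_1a_2a_3$ and regular hexagonal base $b_0b_1b_2b_3b_4b_5$ (in cyclic order), whose remaining faces are the squares $a_2a_3b_1b_0$, $a_3a_1b_3b_2$, $a_1a_2b_5b_4$ and the triangles $t_1=a_1b_3b_4$, $t_2=a_2b_5b_0$, $t_3=a_3b_1b_2$. The edges not in the base form three planar paths $\mathcal P_1=b_2a_3a_2b_5$, $\mathcal P_2=b_1a_3a_1b_4$, $\mathcal P_3=b_0a_2a_1b_3$, the plane of $\mathcal P_i$ being parallel to $t_i$. Cut $P$ by five planes, each time discarding one side of the plane, as follows. 1. (cut1) A plane parallel to $t_1$ that crosses the end edges $a_3b_1$ of $\mathcal P_2$ and $a_2b_0$ of $\mathcal P_3$ at interior points; the side of $b_0,b_1$ is discarded. 2. (cut2, a pair) Two planes perpendicular to the base and to the plane of $t_1$, one crossing the end edge $a_3b_2$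 of $\mathcal P_1$ at an interior point, the side of $b_2$ being discarded, the other crossing the end edge $a_2b_5$ of $\mathcal P_1$ at an interior point, the side of $b_5$ being discarded. 3. (cut3) A plane parallel to the base and strictly between the base and the top triangle; the side of the top triangle is discarded. 4. (cut4) A plane that strictly separates the vertex $a_1$ (the common vertex of $\mathcal P_2$ and $\mathcal P_3$) from all other vertices of $P$, and whose intersection with the solid left by the preceding cuts is a (nondegenerate) rectangle; the side of $a_1$ is discarded. Assume that the cuts do not run into one another: among the plane sections of $P$ made by cut1, by the two planes of cut2 and by cut3, the section of cut1 is disjoint from those of the two cut2 and of cut3, and the sections of the two cut2 are disjoint from that of cut3. Then the resulting solid, called an equitruncated triangular cupola, is $11$-equiprojective. -/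

import Mathlib

/-- Euclidean three-space. -/
abbrev E3 : Type := EuclideanSpace ℝ (Fin 3)

/-! ### Half-spaces, polyhedra, faces, polygons, shadows -/

/-- A plane `{x | ⟪normal, x⟫ = offset}` together with one of its sides,
the side `⟪normal, x⟫ ≤ offset`. -/
structure HalfSpace where
  normal : E3
  offset : ℝ
  normal_ne_zero : normal ≠ 0

namespace HalfSpace

/-- The closed half-space. -/
def carrier (H : HalfSpace) : Set E3 := {x | inner ℝ H.normal x ≤ H.offset}

/-- The bounding plane. -/
def plane (H : HalfSpace) : Set E3 := {x | inner ℝ H.normal x = H.offset}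

/-- The vectors parallel to the bounding plane. -/
noncomputable def direction (H : HalfSpace) : Submodule ℝ E3 := (Submodule.span ℝ {H.normal})ᗮ

/-- `x` lies strictly on the side that is kept. -/
def Keeps (H : HalfSpace) (x : E3) : Prop := inner ℝ H.normal x < H.offset

/-- `x` lies strictly on the side that is cut away. -/
def Removes (H : HalfSpace) (x : E3) : Prop := H.offset < inner ℝ H.normal x

end HalfSpace

/-- A (bounded, three-dimensional) convex polyhedron: a bounded intersection of finitely many
half-spaces with nonempty interior. -/
def IsConvexPolyhedron (P : Set E3) : Prop :=
  (∃ (n : ℕ) (H : Fin n → HalfSpace), P = ⋂ i, (H i).carrier) ∧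
    Bornology.IsBounded P ∧ (interior P).Nonempty

/-- A face (facet) of `P`: an exposed subset of `P` of affine dimension two. -/
def IsFace (P F : Set E3) : Prop :=
  IsExposed ℝ P F ∧ Module.finrank ℝ (vectorSpan ℝ F) = 2

/-- `Q` is a convex polygon with exactly `k` vertices (the convex hull of finitely many points,
of affine dimension two, with `k` extreme points). -/
def IsConvexPolygon (k : ℕ) (Q : Set E3) : Prop :=
  (∃ s : Finset E3, Q = convexHull ℝ (s : Set E3)) ∧
    Module.finrank ℝ (vectorSpan ℝ Q) = 2 ∧ (Set.extremePoints ℝ Q).ncard = k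

/-- The shadow of `P` in direction `u`: its orthogonal projection to the plane orthogonal
to `u`. -/
noncomputable def shadow (u : E3) (P : Set E3) : Set E3 :=
  (Submodule.span ℝ {u})ᗮ.starProjection '' P

/-- `P` is a convex polyhedron whose shadow is a `k`-gon in every direction that is not
parallel to a face of `P`. -/
def IsEquiprojective (k : ℕ) (P : Set E3) : Prop :=
  IsConvexPolyhedron P ∧
    ∀ u : E3, u ≠ 0 → (∀ F : Set E3, IsFace P F → u ∉ vectorSpan ℝ F) →
      IsConvexPolygon k (shadow u P)

/-- A (nondegenerate) rectangle with corner `p` and orthogonal sides `v`, `w`. -/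
def IsRectangle (R : Set E3) : Prop :=
  ∃ p v w : E3, v ≠ 0 ∧ w ≠ 0 ∧ inner ℝ v w = 0 ∧
    R = {x | ∃ s t : ℝ, 0 ≤ s ∧ s ≤ 1 ∧ 0 ≤ t ∧ t ≤ 1 ∧ x = p + s • v + t • w}

/-! ### The triangular cupola -/

/-- The top triangle of the model cupola with edge length `√2`, one half of the cuboctahedron
whose vertices are the permutations of `(±1, ±1, 0)`. -/
noncomputable def cupolaTop : Fin 3 → E3 :=
  ![!₂[0, 1, 1], !₂[1, 0, 1], !₂[1, 1, 0]]

/-- The base hexagon of the model cupola, in cyclic order. -/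
noncomputable def cupolaBase : Fin 6 → E3 :=
  ![!₂[1, -1, 0], !₂[1, 0, -1], !₂[0, 1, -1], !₂[-1, 1, 0], !₂[-1, 0, 1], !₂[0, -1, 1]]

/-- A triangular cupola (the Johnson solid with regular faces, of any size and in any position),
with its vertices labelled: top triangle `a 0, a 1, a 2`, base hexagon `b 0, …, b 5`.
The other faces are
* the squares `a 1, a 2, b 1, b 0` and `a 2, a 0, b 3, b 2` and `a 0, a 1, b 5, b 4`;
* the triangles `t₁ = a 0, b 3, b 4` and `t₂ = a 1, b 5, b 0` and `t₃ = a 2, b 1, b 2`.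

The edges outside the base form the three planar paths
`𝒫₁ = b 2, a 2, a 1, b 5`, `𝒫₂ = b 1, a 2, a 0, b 4` and `𝒫₃ = b 0, a 1, a 0, b 3`,
the plane of `𝒫ᵢ` being parallel to `tᵢ`. The common vertex of `𝒫₂` and `𝒫₃` is `a 0`. -/
structure TriangularCupola where
  a : Fin 3 → E3
  b : Fin 6 → E3
  similar_model : ∃ f : E3 ≃ᵈ E3, (∀ i, a i = f (cupolaTop i)) ∧ ∀ i, b i = f (cupolaBase i)

namespace TriangularCupola

/-- The solid cupola. -/
def solid (C : TriangularCupola) : Set E3 := convexHull ℝ (Set.range C.a ∪ Set.range C.b)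

/-- The vectors parallel to the base. -/
noncomputable def baseDirection (C : TriangularCupola) : Submodule ℝ E3 := vectorSpan ℝ (Set.range C.b)

/-- The vectors parallel to the triangle `t₁`. -/
noncomputable def t₁Direction (C : TriangularCupola) : Submodule ℝ E3 := vectorSpan ℝ {C.a 0, C.b 3, C.b 4}

/-- The cuts that turn a triangular cupola into an equitruncated one. Each cut is given by its
plane and the side that is kept. -/
structure Equitruncation (C : TriangularCupola) where
  cut1 : HalfSpace
  cut2 : HalfSpace
  cut2' : HalfSpace
  cut3 : HalfSpace
  cut4 : HalfSpace
  /-- cut1 is parallel to `t₁`. -/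
  cut1_parallel : cut1.direction = C.t₁Direction
  /-- cut1 cuts the end edge `a 2, b 1` of `𝒫₂` between its ends. -/
  cut1_edge₂ : cut1.Keeps (C.a 2) ∧ cut1.Removes (C.b 1)
  /-- cut1 cuts the end edge `a 1, b 0` of `𝒫₃` between its ends. -/
  cut1_edge₃ : cut1.Keeps (C.a 1) ∧ cut1.Removes (C.b 0)
  /-- The two planes of cut2 are perpendicular to the base and to the plane of `t₁`. -/
  cut2_perp : cut2.normal ∈ C.baseDirection ∧ cut2.normal ∈ C.t₁Direction
  cut2'_perp : cut2'.normal ∈ C.baseDirection ∧ cut2'.normal ∈ C.t₁Direction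
  /-- They cut the two end edges `a 2, b 2` and `a 1, b 5` of `𝒫₁` between their ends. -/
  cut2_edge : cut2.Keeps (C.a 2) ∧ cut2.Removes (C.b 2)
  cut2'_edge : cut2'.Keeps (C.a 1) ∧ cut2'.Removes (C.b 5)
  /-- cut3 is parallel to the base and cuts off the top triangle. -/
  cut3_parallel : cut3.direction = C.baseDirection
  cut3_top : (∀ i, cut3.Removes (C.a i)) ∧ ∀ i, cut3.Keeps (C.b i)
  /-- cut4 cuts off the common vertex `a 0` of `𝒫₂` and `𝒫₃`, and no other vertex of `C`. -/
  cut4_vertex : cut4.Removes (C.a 0) ∧ (∀ i, i ≠ 0 → cut4.Keeps (C.a i)) ∧ ∀ i, cut4.Keeps (C.b i)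
  /-- cut4 creates a rectangle in the resulting solid. -/
  cut4_rectangle : IsRectangle
    (C.solid ∩ cut1.carrier ∩ cut2.carrier ∩ cut2'.carrier ∩ cut3.carrier ∩ cut4.plane)
  /-- The plane sections of the cupola made by cut1, by the two cut2 and by cut3 do not run
  into one another. -/
  disjoint_cut1_cut2 : Disjoint (C.solid ∩ cut1.plane) (C.solid ∩ cut2.plane)
  disjoint_cut1_cut2' : Disjoint (C.solid ∩ cut1.plane) (C.solid ∩ cut2'.plane)
  disjoint_cut1_cut3 : Disjoint (C.solid ∩ cut1.plane) (C.solid ∩ cut3.plane)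
  disjoint_cut2_cut3 : Disjoint (C.solid ∩ cut2.plane) (C.solid ∩ cut3.plane)
  disjoint_cut2'_cut3 : Disjoint (C.solid ∩ cut2'.plane) (C.solid ∩ cut3.plane)

/-- The equitruncated triangular cupola: what the cuts leave of the cupola. -/
def Equitruncation.solid {C : TriangularCupola} (K : C.Equitruncation) : Set E3 :=
  C.solid ∩ K.cut1.carrier ∩ K.cut2.carrier ∩ K.cut2'.carrier ∩ K.cut3.carrier ∩ K.cut4.carrier

end TriangularCupola

open Set

/-! ### Affine functionals on Euclidean space -/

/-! Let u be parallel to no facet. A vertex of a polyhedron projects along u to a vertex of the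
shadow exactly when the outward normals of the facets through it take both signs on u. If they do, a
positive combination of them vanishes on u and is maximal at that vertex alone
(`exists_functional`); if not, the line through the vertex in direction u enters the interior
(`exists_interior_of_not_mixed`). Equiprojectivity thus becomes a count of mixed vertices
(`ncard_extremePoints_shadow`).

In coordinates (x, s, t) = (x, y + z, y - z) the twelve facet normals are, up to sign, the nine
forms x, s, t, x ± s, x ± t, s ± t; opposite normals belong to t₁ and cut1, to the base and cut3,
and to the two cut2. As long as the cuts do not collide, normals and incidences do not depend on
their positions: there are 20 vertices, each on three facets. A finite check shows that every sign
pattern compatible with the linear relations among the nine forms is mixed at exactly 11 vertices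
(`card_nonconstant_signs`).

It remains to put the cuts into this form (`Equitruncation.exists_offsets`). The directions of cut1,
cut2 and cut3 are prescribed, and disjointness of the sections gives the inequalities on the
offsets. The direction of cut4 is forced by its rectangular section (`plane_of_parallelogram`): the
section can be bounded only by the two squares and t₁ at `a 0` and by cut3. Opposite sides are
parallel to two of these four, and since the plane crosses all four edges at `a 0`, the only
possible pairs are the two squares, and t₁ with cut3. Hence the plane is s = const. -/

theorem AffineMap.apply_add_eq (g : E3 →ᵃ[ℝ] ℝ) (x w : E3) :
    g (x + w) = g x + g.linear w := by
  have := g.map_vadd x w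
  simpa [add_comm] using this

theorem eventually_affine_neg (g : E3 →ᵃ[ℝ] ℝ) {x : E3} (w : E3) (hx : g x < 0) :
    ∀ᶠ r in nhds (0 : ℝ), g (x + r • w) < 0 := by
  have hc : Continuous fun r : ℝ => g (x + r • w) :=
    g.continuous_of_finiteDimensional.comp (by fun_prop)
  exact hc.continuousAt.eventually (p := fun y => y < 0)
    (gt_mem_nhds (by simpa using hx))

/-- No value on F is positive, so the midpoint of a point strict for the earlier functionals and a
point strict for the new one is strict for all. -/
theorem exists_forall_affine_neg {κ : Type*} {F : Set E3} (hF : Convex ℝ F) (hne : F.Nonempty)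
    (g : κ → E3 →ᵃ[ℝ] ℝ) (K : Finset κ) (hle : ∀ k ∈ K, ∀ x ∈ F, g k x ≤ 0)
    (hlt : ∀ k ∈ K, ∃ x ∈ F, g k x < 0) : ∃ x ∈ F, ∀ k ∈ K, g k x < 0 := by
  classical
  induction K using Finset.induction_on with
  | empty => exact ⟨hne.some, hne.some_mem, by simp⟩
  | insert k K _ ih =>
    obtain ⟨p, hp, hpK⟩ := ih (fun k hk => hle k (Finset.mem_insert_of_mem hk))
      (fun k hk => hlt k (Finset.mem_insert_of_mem hk))
    obtain ⟨q, hq, hqk⟩ := hlt k (Finset.mem_insert_self _ _)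
    refine ⟨midpoint ℝ p q, hF.midpoint_mem hp hq, fun k' hk' => ?_⟩
    have h1 := hle k' hk' p hp
    have h2 := hle k' hk' q hq
    have h3 : g k' (midpoint ℝ p q) = (1 / 2 : ℝ) * (g k' p + g k' q) := by
      rw [AffineMap.map_midpoint, midpoint_eq_smul_add]; simp
    rw [h3]
    rcases Finset.mem_insert.1 hk' with rfl | hk
    · linarith
    · linarith [hpK k' hk]

theorem exists_pos_weights {κ : Type*} (K : Finset κ) (a : κ → ℝ) {k₀ k₁ : κ} (h₀ : k₀ ∈ K)
    (h₁ : k₁ ∈ K) (ha₀ : 0 < a k₀) (ha₁ : a k₁ < 0) :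
    ∃ α : κ → ℝ, (∀ k, 0 < α k) ∧ ∑ k ∈ K, α k * a k = 0 := by
  classical
  set S := ∑ k ∈ K, a k
  -- All weights start at 1; the excess S is then cancelled by raising the weight of k₁ if S is
  -- positive, of k₀ if S is negative.
  refine ⟨fun k => 1 + (if k = k₁ then max S 0 / (-a k₁) else 0)
    + (if k = k₀ then max (-S) 0 / a k₀ else 0), fun k => ?_, ?_⟩
  · have h1 : 0 ≤ max S 0 / (-a k₁) := div_nonneg (le_max_right _ _) (by linarith)
    have h2 : 0 ≤ max (-S) 0 / a k₀ := div_nonneg (le_max_right _ _) ha₀.le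
    have h3 : 0 ≤ if k = k₁ then max S 0 / (-a k₁) else 0 := by split_ifs <;> simp [h1]
    have h4 : 0 ≤ if k = k₀ then max (-S) 0 / a k₀ else 0 := by split_ifs <;> simp [h2]
    linarith
  · simp only [add_mul, one_mul, ite_mul, zero_mul, Finset.sum_add_distrib,
      Finset.sum_ite_eq', h₀, h₁, if_true]
    have e1 : max S 0 / (-a k₁) * a k₁ = - max S 0 := by field_simp [ha₁.ne]
    have e2 : max (-S) 0 / a k₀ * a k₀ = max (-S) 0 := by field_simp [ha₀.ne']
    rw [e1, e2]
    rcases le_total 0 S with h | h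
    · rw [max_eq_left h, max_eq_right (by linarith)]; ring
    · rw [max_eq_right h, max_eq_left (by linarith)]; ring

/-! ### Polyhedra presented by their facets and vertices -/

/-- A polyhedron given by facet functionals `g` (nonpositive on the solid) and by its
vertices `v`, where `inc i` is the set of facets through the vertex `v i`. -/
structure FacetVertexSystem (κ ι : Type*) where
  g : κ → E3 →ᵃ[ℝ] ℝ
  v : ι → E3
  inc : ι → Finset κ
  g_eq : ∀ i, ∀ k ∈ inc i, g k (v i) = 0
  g_neg : ∀ i, ∀ k ∉ inc i, g k (v i) < 0
  hull : ∀ x, (∀ k, g k x ≤ 0) → x ∈ convexHull ℝ (range v)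
  -- With `g_neg`, this makes a positive combination of the normals at one vertex peak at that
  -- vertex only.
  inc_not_subset : ∀ i j, i ≠ j → ∃ k ∈ inc i, k ∉ inc j
  exists_mem_inc : ∀ k, ∃ i, k ∈ inc i
  exists_notMem_inc : ∀ k, ∃ i, k ∉ inc i
  exists_mem_notMem_inc : ∀ k k', k' ≠ k → ∃ i, k ∈ inc i ∧ k' ∉ inc i

namespace FacetVertexSystem

variable {κ ι : Type*} (S : FacetVertexSystem κ ι)

/-- The solid cut out by the facet functionals. -/
def solid : Set E3 := {x | ∀ k, S.g k x ≤ 0}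

/-- The facet normals at the vertex `i` take both signs on `u`. -/
def Mixed (u : E3) (i : ι) : Prop :=
  (∃ k ∈ S.inc i, 0 < (S.g k).linear u) ∧ ∃ k ∈ S.inc i, (S.g k).linear u < 0

theorem g_vertex_nonpos (i : ι) (k : κ) : S.g k (S.v i) ≤ 0 := by
  by_cases h : k ∈ S.inc i
  · exact (S.g_eq i k h).le
  · exact (S.g_neg i k h).le

theorem vertex_mem (i : ι) : S.v i ∈ S.solid := fun k => S.g_vertex_nonpos i k

theorem convex_solid : Convex ℝ S.solid := by
  have : S.solid = ⋂ k, (S.g k) ⁻¹' Iic 0 := by ext; simp [solid]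
  rw [this]
  exact convex_iInter fun k => (convex_Iic 0).affine_preimage _

theorem solid_eq_convexHull : S.solid = convexHull ℝ (range S.v) :=
  Subset.antisymm S.hull (convexHull_min (range_subset_iff.2 S.vertex_mem) S.convex_solid)

theorem linear_ne_zero (k : κ) : (S.g k).linear ≠ 0 := by
  intro h
  obtain ⟨i, hi⟩ := S.exists_mem_inc k
  obtain ⟨j, hj⟩ := S.exists_notMem_inc k
  have h1 := (S.g k).apply_add_eq (S.v i) (S.v j - S.v i)
  rw [h, add_sub_cancel, S.g_eq i k hi] at h1
  have := S.g_neg j k hj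
  simp at h1; linarith

theorem exists_interior [Fintype κ] [Nonempty ι] : ∃ x, ∀ k, S.g k x < 0 := by
  obtain ⟨x, -, hx⟩ := exists_forall_affine_neg S.convex_solid
    ⟨_, S.vertex_mem (Classical.arbitrary ι)⟩ S.g Finset.univ (fun k _ x hx => hx k)
    (fun k _ => (S.exists_notMem_inc k).imp' S.v fun i hi => ⟨S.vertex_mem i, S.g_neg i k hi⟩)
  exact ⟨x, fun k => hx k (Finset.mem_univ k)⟩

theorem mem_interior [Finite κ] {x : E3} (hx : ∀ k, S.g k x < 0) : x ∈ interior S.solid := by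
  refine _root_.mem_interior.2 ⟨⋂ k, (S.g k) ⁻¹' Iio 0, fun y hy k => ?_, ?_, by simpa using hx⟩
  · exact (mem_iInter.1 hy k).le
  · exact isOpen_iInter_of_finite fun k =>
      isOpen_Iio.preimage (S.g k).continuous_of_finiteDimensional

theorem interior_nonempty [Fintype κ] [Nonempty ι] : (interior S.solid).Nonempty :=
  S.exists_interior.imp fun _ hx => S.mem_interior hx

theorem isConvexPolyhedron [Fintype κ] [Finite ι] [Nonempty ι] :
    IsConvexPolyhedron S.solid := by
  refine ⟨?_, ?_, S.interior_nonempty⟩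
  · let n : κ → E3 := fun k => (InnerProductSpace.toDual ℝ E3).symm
      (LinearMap.toContinuousLinearMap (S.g k).linear)
    have hn : ∀ k x, inner ℝ (n k) x = (S.g k).linear x := fun k x => by simp [n]
    have hg : ∀ k x, S.g k x = inner ℝ (n k) x + S.g k 0 := fun k x => by
      have := (S.g k).apply_add_eq 0 x
      rw [hn, zero_add] at *; linarith
    let H : κ → HalfSpace := fun k => ⟨n k, -S.g k 0, fun h => S.linear_ne_zero k <|
      LinearMap.ext fun x => by rw [← hn, h]; simp⟩
    let e := Fintype.equivFin κ
    refine ⟨Fintype.card κ, H ∘ e.symm, ?_⟩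
    ext x
    rw [mem_iInter]
    refine Iff.trans (forall_congr' fun k => ?_) (e.symm.surjective.forall (p := fun k => x ∈ (H k).carrier))
    show S.g k x ≤ 0 ↔ x ∈ (H k).carrier
    simp only [HalfSpace.carrier, mem_ofPred_eq, H]
    rw [hg]
    constructor <;> intro h <;> linarith
  · rw [S.solid_eq_convexHull, isBounded_convexHull]
    exact (finite_range _).isBounded

/-- The facet on which `g k` vanishes. -/
def facet (k : κ) : Set E3 := {x ∈ S.solid | S.g k x = 0}

/-- Such a point can move slightly in every direction of the kernel of the facet normal without
leaving the facet, which determines the span of the facet. -/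
theorem exists_facet_relInterior [Fintype κ] (k : κ) :
    ∃ x, S.g k x = 0 ∧ ∀ k', k' ≠ k → S.g k' x < 0 := by
  classical
  have hc : Convex ℝ (S.facet k) :=
    S.convex_solid.inter ((convex_singleton (0 : ℝ)).affine_preimage (S.g k))
  obtain ⟨i, hi⟩ := S.exists_mem_inc k
  obtain ⟨x, hx, hx'⟩ := exists_forall_affine_neg hc ⟨S.v i, S.vertex_mem i, S.g_eq i k hi⟩ S.g
    (Finset.univ.erase k) (fun k' _ x hx => hx.1 k') (fun k' hk' => by
      obtain ⟨j, hj, hj'⟩ := S.exists_mem_notMem_inc k k' (Finset.ne_of_mem_erase hk')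
      exact ⟨S.v j, ⟨S.vertex_mem j, S.g_eq j k hj⟩, S.g_neg j k' hj'⟩)
  exact ⟨x, hx.2, fun k' hk' => hx' k' (Finset.mem_erase.2 ⟨hk', Finset.mem_univ _⟩)⟩

theorem vectorSpan_facet [Fintype κ] (k : κ) :
    vectorSpan ℝ (S.facet k) = LinearMap.ker (S.g k).linear := by
  apply le_antisymm
  · rw [vectorSpan_def, Submodule.span_le]
    rintro _ ⟨x, hx, y, hy, rfl⟩
    have := (S.g k).linearMap_vsub x y
    rw [hx.2, hy.2] at this
    simpa using this
  · intro w hw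
    obtain ⟨x, hx, hx'⟩ := S.exists_facet_relInterior k
    have hev : ∀ᶠ r in nhds (0 : ℝ), ∀ k', k' ≠ k → S.g k' (x + r • w) < 0 :=
      Filter.eventually_all.2 fun k' => by
        by_cases h : k' = k
        · simp [h]
        · simpa [h] using eventually_affine_neg (S.g k') w (hx' k' h)
    obtain ⟨ε, hε, h⟩ := Metric.eventually_nhds_iff.1 hev
    have hk : ∀ r : ℝ, S.g k (x + r • w) = 0 := fun r => by
      rw [AffineMap.apply_add_eq, hx, map_smul, LinearMap.mem_ker.1 hw]; simp
    have hmem : ∀ r : ℝ, |r| < ε → x + r • w ∈ S.facet k := fun r hr =>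
      ⟨fun k' => by
        by_cases h' : k' = k
        · rw [h', hk]
        · exact (h (by simpa using hr) k' h').le, hk r⟩
    have h1 := vsub_mem_vectorSpan ℝ (hmem (ε / 2) (by rw [abs_of_pos] <;> linarith))
      (hmem 0 (by simpa using hε))
    simp only [zero_smul, add_zero, vsub_eq_sub, add_sub_cancel_left] at h1
    exact (Submodule.smul_mem_iff _ (by positivity : ε / 2 ≠ 0)).1 h1

theorem isFace_facet [Fintype κ] (k : κ) : IsFace S.solid (S.facet k) := by
  refine ⟨fun _ => ⟨LinearMap.toContinuousLinearMap (S.g k).linear, ?_⟩, ?_⟩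
  · obtain ⟨i, hi⟩ := S.exists_mem_inc k
    have key : ∀ x y, (S.g k).linear x - (S.g k).linear y = S.g k x - S.g k y := fun x y => by
      rw [← map_sub]; exact (S.g k).linearMap_vsub x y
    ext x
    simp only [facet, mem_ofPred_eq, LinearMap.coe_toContinuousLinearMap']
    refine and_congr_right fun hx => ⟨fun h y hy => ?_, fun h => ?_⟩
    · have := key y x; have := hy k; linarith
    · have h1 := h _ (S.vertex_mem i)
      have h2 := key (S.v i) x
      have h3 := hx k
      rw [S.g_eq i k hi] at h2; linarith
  · rw [S.vectorSpan_facet]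
    have h1 := LinearMap.finrank_range_add_finrank_ker (S.g k).linear
    have h2 : LinearMap.range (S.g k).linear = ⊤ :=
      LinearMap.range_eq_top.2 (LinearMap.surjective (S.linear_ne_zero k))
    rw [h2, finrank_top] at h1
    simp at h1; omega

/-! ### The vertices of a shadow -/

/-- Since both signs occur, the normals at the vertex have a strictly positive combination vanishing
on u; it descends to the shadow and exposes the projected vertex. -/
theorem exists_functional [DecidableEq ι] {u : E3} {i : ι} (hi : S.Mixed u i) :
    ∃ N : E3 →ₗ[ℝ] ℝ, N u = 0 ∧ ∀ j, j ≠ i → N (S.v j) < N (S.v i) := by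
  obtain ⟨⟨k₀, hk₀, h₀⟩, k₁, hk₁, h₁⟩ := hi
  obtain ⟨α, hα, hsum⟩ := exists_pos_weights (S.inc i) (fun k => (S.g k).linear u) hk₀ hk₁ h₀ h₁
  refine ⟨∑ k ∈ S.inc i, α k • (S.g k).linear, by simpa using hsum, fun j hj => ?_⟩
  rw [← sub_neg, ← map_sub]
  obtain ⟨k, hk, hk'⟩ := S.inc_not_subset i j hj.symm
  simp only [LinearMap.sum_apply, LinearMap.smul_apply, smul_eq_mul]
  have hterm : ∀ k ∈ S.inc i, (S.g k).linear (S.v j - S.v i) = S.g k (S.v j) := fun k hk => by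
    have := (S.g k).linearMap_vsub (S.v j) (S.v i)
    rw [S.g_eq i k hk] at this; simpa using this
  refine Finset.sum_neg' (fun k hk => ?_) ⟨k, hk, ?_⟩
  · rw [hterm k hk]
    exact mul_nonpos_of_nonneg_of_nonpos (hα k).le (S.g_vertex_nonpos j k)
  · rw [hterm k hk]
    exact mul_neg_of_pos_of_neg (hα k) (S.g_neg j k hk')

/-- A short move along u or -u makes all functionals vanishing at the vertex negative at once; the
others stay negative by continuity. -/
theorem exists_interior_of_not_mixed [Fintype κ] {u : E3} {i : ι}
    (hu : ∀ k, (S.g k).linear u ≠ 0) (hi : ¬ S.Mixed u i) :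
    ∃ r : ℝ, ∀ k, S.g k (S.v i + r • u) < 0 := by
  suffices H : ∀ w : E3, (∀ k ∈ S.inc i, (S.g k).linear w < 0) →
      ∃ r : ℝ, ∀ k, S.g k (S.v i + r • w) < 0 by
    by_cases h : ∃ k ∈ S.inc i, 0 < (S.g k).linear u
    · obtain ⟨r, hr⟩ := H (-u) fun k hk => by
        rw [map_neg, neg_lt_zero]
        by_contra hn
        exact hi ⟨h, k, hk, lt_of_le_of_ne (not_lt.1 hn) (hu k)⟩
      exact ⟨-r, by simpa using hr⟩
    · push Not at h
      exact H u fun k hk => lt_of_le_of_ne (h k hk) (hu k)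
  intro w hw
  have hev : ∀ᶠ r in nhdsWithin (0 : ℝ) (Ioi 0), ∀ k, S.g k (S.v i + r • w) < 0 := by
    refine Filter.eventually_all.2 fun k => ?_
    by_cases hk : k ∈ S.inc i
    · filter_upwards [self_mem_nhdsWithin] with r hr
      rw [AffineMap.apply_add_eq, S.g_eq i k hk, map_smul, zero_add]
      exact mul_neg_of_pos_of_neg hr (hw k hk)
    · exact (eventually_affine_neg _ w (S.g_neg i k hk)).filter_mono nhdsWithin_le_nhds
  exact hev.exists

/-- An interior point can move both ways along a nonzero vector orthogonal to u, and its projection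
moves with it. -/
theorem proj_notMem_extremePoints [Fintype κ] {u x : E3} (hx : ∀ k, S.g k x < 0) :
    (Submodule.span ℝ {u})ᗮ.starProjection x ∉ extremePoints ℝ (shadow u S.solid) := by
  intro hext
  have hne : (Submodule.span ℝ {u})ᗮ ≠ ⊥ := fun h => by
    have h1 := Submodule.finrank_add_finrank_orthogonal (Submodule.span ℝ {u})
    have h2 := finrank_span_le_card (R := ℝ) ({u} : Set E3)
    rw [h] at h1
    simp at h1 h2; omega
  obtain ⟨w, hw, hw0⟩ := Submodule.exists_mem_ne_zero_of_ne_bot hne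
  have hev : ∀ᶠ r in nhds (0 : ℝ), ∀ k, S.g k (x + r • w) < 0 :=
    Filter.eventually_all.2 fun k => eventually_affine_neg _ w (hx k)
  obtain ⟨ε, hε, h⟩ := Metric.eventually_nhds_iff.1 hev
  have hmem : ∀ r : ℝ, |r| < ε → (Submodule.span ℝ {u})ᗮ.starProjection x + r • w ∈
      shadow u S.solid := fun r hr => ⟨x + r • w, fun k => (h (by simpa using hr) k).le, by
        rw [map_add, map_smul, Submodule.starProjection_eq_self_iff.2 hw]⟩
  have hε2 : |ε / 2| < ε := by rw [abs_of_pos] <;> linarith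
  have h3 := (mem_extremePoints.1 hext).2 _ (hmem (ε / 2) hε2) _
    (hmem (-(ε / 2)) (by rwa [abs_neg]))
    ⟨1 / 2, 1 / 2, by norm_num, by norm_num, by norm_num, by module⟩
  have h4 : (ε / 2) • w = 0 := by simpa using h3.1
  exact hw0 ((smul_eq_zero.1 h4).resolve_left (by positivity))

/-- Confines the shadow to an open half-space with one boundary point added, a set in which that
point is extreme. -/
theorem convex_insert_lt {E : Type*} [AddCommGroup E] [Module ℝ E] (N : E →ₗ[ℝ] ℝ) (p : E) :
    Convex ℝ {z | z = p ∨ N z < N p} := by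
  refine convex_iff_forall_pos.2 fun x hx y hy a b ha hb hab => ?_
  have hN : N (a • x + b • y) = a * N x + b * N y := by simp
  have hp : N p = a * N p + b * N p := by rw [← add_mul, hab, one_mul]
  rcases hx with rfl | hx <;> rcases hy with rfl | hy
  · left; rw [← add_smul, hab, one_smul]
  all_goals
    right
    show N _ < N _
    rw [hN]
  · linarith [mul_lt_mul_of_pos_left hy hb]
  · linarith [mul_lt_mul_of_pos_left hx ha]
  · linarith [mul_lt_mul_of_pos_left hy hb, mul_lt_mul_of_pos_left hx ha]

theorem functional_starProjection {u : E3} {N : E3 →ₗ[ℝ] ℝ} (hN : N u = 0) (x : E3) :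
    N ((Submodule.span ℝ {u})ᗮ.starProjection x) = N x := by
  have h := Submodule.starProjection_add_starProjection_orthogonal (K := Submodule.span ℝ {u}) x
  obtain ⟨r, hr⟩ := Submodule.mem_span_singleton.1
    (Submodule.starProjection_apply_mem (Submodule.span ℝ {u}) x)
  conv_rhs => rw [← h, map_add, ← hr, map_smul, hN, smul_zero, zero_add]

theorem shadow_solid (u : E3) : shadow u S.solid =
    convexHull ℝ (range fun i => (Submodule.span ℝ {u})ᗮ.starProjection (S.v i)) := by
  have := (Submodule.span ℝ {u})ᗮ.starProjection.toLinearMap.image_convexHull (range S.v)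
  rw [shadow, S.solid_eq_convexHull]
  refine this.trans ?_
  rw [← range_comp]; rfl

theorem extremePoints_shadow [Fintype κ] {u : E3} (hu : ∀ k, (S.g k).linear u ≠ 0) :
    extremePoints ℝ (shadow u S.solid) =
      (fun i => (Submodule.span ℝ {u})ᗮ.starProjection (S.v i)) '' {i | S.Mixed u i} := by
  classical
  apply Subset.antisymm
  · intro z hz
    have h1 := hz
    rw [S.shadow_solid] at h1
    obtain ⟨i, rfl⟩ := extremePoints_convexHull_subset h1
    refine ⟨i, ?_, rfl⟩
    by_contra hi
    obtain ⟨r, hr⟩ := S.exists_interior_of_not_mixed hu hi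
    refine S.proj_notMem_extremePoints (u := u) hr ?_
    have h0 : (Submodule.span ℝ {u})ᗮ.starProjection u = 0 :=
      Submodule.starProjection_orthogonal_apply_eq_zero (Submodule.mem_span_singleton_self u)
    rwa [map_add, map_smul, h0, smul_zero, add_zero]
  · rintro _ ⟨i, hi, rfl⟩
    obtain ⟨N, hNu, hN⟩ := S.exists_functional hi
    set p := (Submodule.span ℝ {u})ᗮ.starProjection (S.v i) with hp
    have hsub : shadow u S.solid ⊆ {z | z = p ∨ N z < N p} := by
      rw [S.shadow_solid]
      refine convexHull_min (range_subset_iff.2 fun j => ?_) (convex_insert_lt N p)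
      by_cases hj : j = i
      · left; rw [hj]
      · right; simp only [hp]
        rw [functional_starProjection hNu, functional_starProjection hNu]; exact hN j hj
    refine mem_extremePoints.2 ⟨⟨S.v i, S.vertex_mem i, rfl⟩, fun x hx y hy hxy => ?_⟩
    obtain ⟨a, b, ha, hb, hab, hpe⟩ := hxy
    have hval : N p = a * N x + b * N y := by simp [p, ← hpe]
    have hp' : N p = a * N p + b * N p := by rw [← add_mul, hab, one_mul]
    rcases hsub hx with h1 | h1 <;> rcases hsub hy with h2 | h2
    · exact ⟨h1, h2⟩
    all_goals exfalso
    · rw [h1] at hval; linarith [mul_lt_mul_of_pos_left h2 hb]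
    · rw [h2] at hval; linarith [mul_lt_mul_of_pos_left h1 ha]
    · linarith [mul_lt_mul_of_pos_left h1 ha, mul_lt_mul_of_pos_left h2 hb]

/-- Distinct mixed vertices keep distinct projections, because the functional peaking at one of them
factors through the projection. -/
theorem ncard_extremePoints_shadow [Fintype κ] {u : E3} (hu : ∀ k, (S.g k).linear u ≠ 0) :
    (extremePoints ℝ (shadow u S.solid)).ncard = {i | S.Mixed u i}.ncard := by
  classical
  rw [S.extremePoints_shadow hu]
  refine InjOn.ncard_image fun i hi j hj hij => ?_
  by_contra hne
  obtain ⟨N, hNu, hN⟩ := S.exists_functional hi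
  have h1 := hN j (Ne.symm hne)
  rw [← functional_starProjection hNu, ← functional_starProjection hNu (S.v i)] at h1
  exact h1.ne (congrArg N hij.symm)

theorem finrank_vectorSpan_shadow [Fintype κ] [Nonempty ι] {u : E3} (hu : u ≠ 0) :
    Module.finrank ℝ (vectorSpan ℝ (shadow u S.solid)) = 2 := by
  have hspan : vectorSpan ℝ S.solid = ⊤ := by
    have h := affineSpan_eq_top_of_nonempty_interior (s := S.solid)
      (by rw [S.convex_solid.convexHull_eq]; exact S.interior_nonempty)
    rw [← direction_affineSpan, h, AffineSubspace.direction_top]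
  have hmap := AffineMap.map_vectorSpan
    (f := (Submodule.span ℝ {u})ᗮ.starProjection.toLinearMap.toAffineMap) (s := S.solid)
  have hs : vectorSpan ℝ (shadow u S.solid) = (Submodule.span ℝ {u})ᗮ := by
    refine Eq.trans hmap.symm ?_
    rw [hspan, Submodule.map_top]
    exact Submodule.range_starProjection _
  rw [hs]
  have h1 := Submodule.finrank_add_finrank_orthogonal (Submodule.span ℝ {u})
  rw [finrank_span_singleton hu] at h1
  simp at h1; omega

/-- If, for every vector on which no facet normal vanishes, exactly `n` vertices have facet normals
of both signs on it, then the solid is `n`-equiprojective. -/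
theorem isEquiprojective [Fintype κ] [Finite ι] [Nonempty ι] {n : ℕ}
    (h : ∀ u : E3, (∀ k, (S.g k).linear u ≠ 0) → {i | S.Mixed u i}.ncard = n) :
    IsEquiprojective n S.solid := by
  refine ⟨S.isConvexPolyhedron, fun u hu hF => ?_⟩
  have hu' : ∀ k, (S.g k).linear u ≠ 0 := fun k hk =>
    hF _ (S.isFace_facet k) (by rw [S.vectorSpan_facet]; exact hk)
  refine ⟨⟨(finite_range fun i =>
    (Submodule.span ℝ {u})ᗮ.starProjection (S.v i)).toFinset, ?_⟩,
    S.finrank_vectorSpan_shadow hu, ?_⟩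
  · rw [Finite.coe_toFinset, S.shadow_solid]
  · rw [S.ncard_extremePoints_shadow hu', h u hu']

end FacetVertexSystem

/-! ### The truncated cupola in coordinates -/

/-- The positions of the cuts of a truncated cupola, in the coordinates `(x, y + z, y - z)`. -/
structure CutOffsets where
  c : ℝ
  d : ℝ
  d' : ℝ
  e : ℝ
  f : ℝ

namespace CutOffsets

variable (Q : CutOffsets)

/-- The linear parts of the twelve facet functionals. -/
def facetForm (k : Fin 12) (p : ℝ × ℝ × ℝ) : ℝ :=
  ![p.1, p.2.1 + p.2.2, p.2.1 - p.2.2, -(p.1 - p.2.1), p.1 + p.2.2, p.1 - p.2.2,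
    -(p.1 + p.2.1), p.1 - p.2.1, p.2.2, -p.2.2, p.1 + p.2.1, p.2.1] k

/-- The values of the linear parts on the facets. -/
def facetValue : Fin 12 → ℝ := ![1, 2, 2, 2, 2, 2, 0, Q.c, Q.d, Q.d', Q.e, Q.f]

/-- The vertices of the truncated cupola. -/
noncomputable def vertex : Fin 20 → ℝ × ℝ × ℝ :=
  ![(2 - Q.d, 2 - Q.d, Q.d), (Q.e / 2, Q.e / 2, 2 - Q.e / 2), (Q.e - Q.f, Q.f, 2 - Q.f),
    (Q.f - 2, Q.f, 2 - Q.f), (-1, 1, 1), (Q.d - 2, 2 - Q.d, Q.d), (1, Q.e - 1, 1),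
    (1, 1 - Q.c, 1), (Q.c / 2, -(Q.c / 2), 2 - Q.c / 2), (2 - Q.d, Q.d - 2, Q.d),
    (2 - Q.d', 2 - Q.d', -Q.d'), (Q.e / 2, Q.e / 2, -(2 - Q.e / 2)),
    (Q.e - Q.f, Q.f, -(2 - Q.f)), (Q.f - 2, Q.f, -(2 - Q.f)), (-1, 1, -1),
    (Q.d' - 2, 2 - Q.d', -Q.d'), (1, Q.e - 1, -1), (1, 1 - Q.c, -1),
    (Q.c / 2, -(Q.c / 2), -(2 - Q.c / 2)), (2 - Q.d', Q.d' - 2, -Q.d')]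

/-- The facets through each vertex. -/
def facetsAt : Fin 20 → Finset (Fin 12) :=
  ![{1, 8, 4}, {1, 4, 10}, {1, 10, 11}, {1, 11, 3}, {1, 3, 6}, {1, 6, 8}, {4, 10, 0}, {4, 0, 7},
    {4, 7, 6}, {4, 6, 8}, {2, 9, 5}, {2, 5, 10}, {2, 10, 11}, {2, 11, 3}, {2, 3, 6}, {2, 6, 9},
    {5, 10, 0}, {5, 0, 7}, {5, 7, 6}, {5, 6, 9}]

/-- The truncated cupola. -/
def model : Set (ℝ × ℝ × ℝ) := {p | ∀ k, facetForm k p ≤ Q.facetValue k}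

theorem mem_model {x s t : ℝ} : (x, s, t) ∈ Q.model ↔
    x ≤ 1 ∧ s + t ≤ 2 ∧ s - t ≤ 2 ∧ s - x ≤ 2 ∧ x + t ≤ 2 ∧ x - t ≤ 2 ∧ 0 ≤ x + s ∧
      x - s ≤ Q.c ∧ t ≤ Q.d ∧ -t ≤ Q.d' ∧ x + s ≤ Q.e ∧ s ≤ Q.f := by
  simp only [model, mem_ofPred_eq, Fin.forall_fin_succ, facetForm, facetValue]
  simp
  grind

/-- The cuts meet the cupola properly and do not run into one another. -/
structure StrictlyAdmissible : Prop where
  one_lt_d : 1 < Q.d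
  d_lt : Q.d < 2
  one_lt_d' : 1 < Q.d'
  d'_lt : Q.d' < 2
  c_lt : Q.c < 2
  e_lt : Q.e < 2
  -- This keeps the vertex (2 - d, d - 2, d) of cut2, where x - s = 2 (2 - d), strictly inside cut1;
  -- the next inequalities play the same role for other pairs of cuts. The bound `f_lt` says f - 2 <
  -- e - f, so that the rectangle has positive width.
  lt_c : 2 * (2 - Q.d) < Q.c
  lt_c' : 2 * (2 - Q.d') < Q.c
  lt_e : 2 * (2 - Q.d) < Q.e
  lt_e' : 2 * (2 - Q.d') < Q.e
  lt_c_add_e : 2 < Q.c + Q.e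
  one_lt_f : 1 < Q.f
  f_lt : Q.f < 1 + Q.e / 2

/-! ### The truncated cupola as the hull of its vertices -/

theorem mem_of_mem_line {E : Type*} [AddCommGroup E] [Module ℝ E] {K : Set E} (hK : Convex ℝ K)
    (F : ℝ → E) (hF : ∀ r, F r = AffineMap.lineMap (F 0) (F 1) r) {a b r : ℝ} (ha : F a ∈ K)
    (hb : F b ∈ K) (har : a ≤ r) (hrb : r ≤ b) : F r ∈ K := by
  have hc := (hK.affine_preimage (AffineMap.lineMap (F 0) (F 1))).ordConnected
  have h := hc.out (x := a) (y := b) (by rwa [mem_preimage, ← hF]) (by rwa [mem_preimage, ← hF])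
    ⟨har, hrb⟩
  rwa [mem_preimage, ← hF] at h

/-- The upper part of the boundary (in the direction of `σ t`) lies in any convex set that contains
the upper vertices. -/
theorem exists_upper {K : Set (ℝ × ℝ × ℝ)} (hK : Convex ℝ K) {c d e f σ : ℝ}
    (v1 : (2 - d, 2 - d, σ * d) ∈ K) (v2 : (e / 2, e / 2, σ * (2 - e / 2)) ∈ K)
    (v3 : (e - f, f, σ * (2 - f)) ∈ K) (v4 : (f - 2, f, σ * (2 - f)) ∈ K)
    (v5 : (-1, 1, σ) ∈ K) (v6 : (d - 2, 2 - d, σ * d) ∈ K) (v7 : (1, e - 1, σ) ∈ K)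
    (v8 : (1, 1 - c, σ) ∈ K) (v9 : (c / 2, -(c / 2), σ * (2 - c / 2)) ∈ K)
    (v10 : (2 - d, d - 2, σ * d) ∈ K) {x s t : ℝ} (hx : x ≤ 1) (hst : s + t ≤ 2)
    (hsx : s - x ≤ 2) (hxt : x + t ≤ 2) (h0 : 0 ≤ x + s) (hxs : x - s ≤ c) (ht : t ≤ d)
    (hxse : x + s ≤ e) (hs : s ≤ f) : ∃ τ, t ≤ τ ∧ (x, s, σ * τ) ∈ K := by
  have diag : ∀ r, 2 - d ≤ r → r ≤ e / 2 → (r, r, σ * (2 - r)) ∈ K := fun r h1 h2 =>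
    mem_of_mem_line hK (fun r => (r, r, σ * (2 - r)))
      (fun r => by simp [AffineMap.lineMap_apply]; ring) (by simpa using v1) v2 h1 h2
  -- The roof is t = min (2 - s, 2 - x, d). Each of the three cases slices the active roof facet by
  -- a segment, at constant s or constant x, whose ends lie on edges of that facet.
  by_cases hY : x ≤ s ∧ 2 - d ≤ s
  · obtain ⟨h1, h2⟩ := hY
    refine ⟨2 - s, by linarith, ?_⟩
    have hl : ∃ l, l ≤ x ∧ (l, s, σ * (2 - s)) ∈ K := by
      rcases le_total s 1 with h | h
      · exact ⟨-s, by linarith, mem_of_mem_line hK (fun r => (-r, r, σ * (2 - r)))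
          (fun r => by simp [AffineMap.lineMap_apply]; ring) (by simpa using v6)
          (by convert v5 using 3; ring) h2 h⟩
      · exact ⟨s - 2, by linarith, mem_of_mem_line hK (fun r => (r - 2, r, σ * (2 - r)))
          (fun r => by simp [AffineMap.lineMap_apply]; constructor <;> ring)
          (by convert v5 using 3 <;> ring) v4 h hs⟩
    have hr : ∃ l, x ≤ l ∧ (l, s, σ * (2 - s)) ∈ K := by
      rcases le_total s (e / 2) with h | h
      · exact ⟨s, h1, diag s h2 h⟩
      · exact ⟨e - s, by linarith, mem_of_mem_line hK (fun r => (e - r, r, σ * (2 - r)))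
          (fun r => by simp [AffineMap.lineMap_apply]; constructor <;> ring)
          (by convert v2 using 2; ring) v3 h hs⟩
    obtain ⟨l, hlx, hl⟩ := hl
    obtain ⟨r, hxr, hr⟩ := hr
    exact mem_of_mem_line hK (fun x => (x, s, σ * (2 - s)))
      (fun r => by simp [AffineMap.lineMap_apply]) hl hr hlx hxr
  by_cases hT : s ≤ x ∧ 2 - d ≤ x
  · obtain ⟨h1, h2⟩ := hT
    refine ⟨2 - x, by linarith, ?_⟩
    have hl : ∃ l, l ≤ s ∧ (x, l, σ * (2 - x)) ∈ K := by
      rcases le_total x (c / 2) with h | h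
      · exact ⟨-x, by linarith, mem_of_mem_line hK (fun r => (r, -r, σ * (2 - r)))
          (fun r => by simp [AffineMap.lineMap_apply]; ring) (by simpa using v10) v9 h2 h⟩
      · exact ⟨x - c, by linarith, mem_of_mem_line hK (fun r => (r, r - c, σ * (2 - r)))
          (fun r => by simp [AffineMap.lineMap_apply]; constructor <;> ring)
          (by convert v9 using 3; ring) (by convert v8 using 3; ring) h hx⟩
    have hr : ∃ l, s ≤ l ∧ (x, l, σ * (2 - x)) ∈ K := by
      rcases le_total x (e / 2) with h | h
      · exact ⟨x, h1, diag x h2 h⟩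
      · exact ⟨e - x, by linarith, mem_of_mem_line hK (fun r => (r, e - r, σ * (2 - r)))
          (fun r => by simp [AffineMap.lineMap_apply]; constructor <;> ring)
          (by convert v2 using 3; ring) (by convert v7 using 3; ring) h hx⟩
    obtain ⟨l, hlx, hl⟩ := hl
    obtain ⟨r, hxr, hr⟩ := hr
    exact mem_of_mem_line hK (fun s => (x, s, σ * (2 - x)))
      (fun r => by simp [AffineMap.lineMap_apply]) hl hr hlx hxr
  · have h1 : x ≤ 2 - d := by grind
    have h2 : s ≤ 2 - d := by grind
    refine ⟨d, ht, ?_⟩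
    have hl := mem_of_mem_line hK (fun r => (r, -r, σ * d))
      (fun r => by simp [AffineMap.lineMap_apply]) (a := d - 2) (by simpa using v6)
      (by simpa using v10) (by linarith) h1
    have hr := mem_of_mem_line hK (fun r => (r, 2 - d, σ * d))
      (fun r => by simp [AffineMap.lineMap_apply]) v6 v1 (by linarith) h1
    exact mem_of_mem_line hK (fun s => (x, s, σ * d))
      (fun r => by simp [AffineMap.lineMap_apply]) hl hr (by linarith) h2

/-- Each point lies on a segment in the t-direction between the upper and lower boundary, the latter
being the former for σ = -1 and d'. Degenerate offsets are allowed, which covers the uncut cupola.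
-/
theorem model_subset : Q.model ⊆ convexHull ℝ (range Q.vertex) := by
  rintro ⟨x, s, t⟩ hp
  obtain ⟨h1, h2, h3, h4, h5, h6, h7, h8, h9, h10, h11, h12⟩ := Q.mem_model.1 hp
  have hK := convex_convexHull ℝ (range Q.vertex)
  have hv : ∀ i, Q.vertex i ∈ convexHull ℝ (range Q.vertex) := fun i =>
    subset_convexHull ℝ _ (mem_range_self i)
  generalize convexHull ℝ (range Q.vertex) = K at hK hv ⊢
  obtain ⟨τ, hτ, hmem⟩ := exists_upper hK (σ := 1) (by simpa [vertex] using hv 0) (by simpa [vertex] using hv 1)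
    (by simpa [vertex] using hv 2) (by simpa [vertex] using hv 3) (by simpa [vertex] using hv 4) (by simpa [vertex] using hv 5)
    (by simpa [vertex] using hv 6) (by simpa [vertex] using hv 7) (by simpa [vertex] using hv 8) (by simpa [vertex] using hv 9)
    h1 h2 h4 h5 h7 h8 h9 h11 h12
  obtain ⟨τ', hτ', hmem'⟩ := exists_upper hK (σ := -1) (t := -t)
    (by simpa only [neg_one_mul] using! hv 10) (by simpa only [neg_one_mul] using! hv 11)
    (by simpa only [neg_one_mul] using! hv 12) (by simpa only [neg_one_mul] using! hv 13)
    (hv 14) (by simpa only [neg_one_mul] using! hv 15) (hv 16) (hv 17)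
    (by simpa only [neg_one_mul] using! hv 18) (by simpa only [neg_one_mul] using! hv 19)
    h1 (by linarith) h4 (by linarith) h7 h8 h10 h11 h12
  exact mem_of_mem_line hK (fun t => (x, s, t)) (fun r => by simp [AffineMap.lineMap_apply])
    hmem' hmem (by linarith) (by linarith)

theorem facetForm_vertex_eq (i : Fin 20) : ∀ k ∈ facetsAt i, facetForm k (Q.vertex i) = Q.facetValue k := by
  fin_cases i <;> simp [facetsAt, facetForm, vertex, facetValue] <;> grind

set_option maxHeartbeats 4000000 in
theorem StrictlyAdmissible.facetForm_vertex_lt {Q : CutOffsets} (h : Q.StrictlyAdmissible)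
    (i : Fin 20) (k : Fin 12) :
    k ∉ facetsAt i → facetForm k (Q.vertex i) < Q.facetValue k := by
  obtain ⟨h1, h2, h3, h4, h5, h6, h7, h8, h9, h10, h11, h12, h13⟩ := h
  fin_cases i <;> fin_cases k <;> simp [facetsAt, facetForm, vertex, facetValue] <;> linarith

end CutOffsets

/-! ### Counting mixed vertices by signs -/

namespace CutOffsets

set_option synthInstance.maxSize 1000 in
set_option synthInstance.maxHeartbeats 400000 in
/-- A sign vector on the facet normals that is consistent with the linear relations among them is
nonconstant at exactly eleven vertices. -/
theorem card_nonconstant_signs : ∀ x s t sp sm tp tm xp xm : Bool,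
    -- A sum of two forms of equal sign has that sign. The last four implications come from
    -- relations such as (s + t) + (x - t) = x + s. All 512 Boolean patterns are checked by
    -- evaluation.
    (x = s → xp = x) → (x = !s → xm = x) → (x = t → tp = x) → (x = !t → tm = x) →
    (s = t → sp = s) → (s = !t → sm = s) → (sp = !tp → xm = !sp) → (sp = tm → xp = sp) →
    (sm = tp → xp = sm) → (sm = !tm → xm = !sm) →
    (Finset.univ.filter fun i : Fin 20 =>
      (∃ k ∈ facetsAt i, ![x, sp, sm, !xm, tp, tm, !xp, xm, t, !t, xp, s] k = true) ∧
      ∃ k ∈ facetsAt i, ![x, sp, sm, !xm, tp, tm, !xp, xm, t, !t, xp, s] k = false).card = 11 := by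
  decide +kernel

theorem decide_pos_neg {a : ℝ} (ha : a ≠ 0) : decide (0 < -a) = !decide (0 < a) := by
  rcases lt_or_gt_of_ne ha with h | h
  · simp [h, h.le]
  · simp [h, h.le]

theorem decide_pos_of_eq {a b c : ℝ} (hc : c = a + b)
    (h : decide (0 < a) = decide (0 < b)) : decide (0 < c) = decide (0 < a) := by
  subst hc
  rw [decide_eq_decide] at h ⊢
  grind

theorem decide_pos_of_eq' {a b c : ℝ} (hb : b ≠ 0) (hc : c = a - b)
    (h : decide (0 < a) = !decide (0 < b)) : decide (0 < c) = decide (0 < a) :=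
  decide_pos_of_eq (b := -b) (by rw [hc]; ring) (by rw [h, decide_pos_neg hb])

theorem card_mixed {p : ℝ × ℝ × ℝ} (hp : ∀ k, facetForm k p ≠ 0) :
    {i : Fin 20 | (∃ k ∈ facetsAt i, 0 < facetForm k p) ∧
      ∃ k ∈ facetsAt i, facetForm k p < 0}.ncard = 11 := by
  obtain ⟨x, s, t⟩ := p
  have hx : x ≠ 0 := hp 0
  have hs : s ≠ 0 := hp 11
  have ht : t ≠ 0 := hp 8
  have hsp : s + t ≠ 0 := hp 1
  have hsm : s - t ≠ 0 := hp 2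
  have htp : x + t ≠ 0 := hp 4
  have htm : x - t ≠ 0 := hp 5
  have hxp : x + s ≠ 0 := hp 10
  have hxm : x - s ≠ 0 := hp 7
  have h := card_nonconstant_signs (decide (0 < x)) (decide (0 < s)) (decide (0 < t))
    (decide (0 < s + t)) (decide (0 < s - t)) (decide (0 < x + t)) (decide (0 < x - t))
    (decide (0 < x + s)) (decide (0 < x - s))
    (decide_pos_of_eq rfl) (decide_pos_of_eq' hs rfl) (decide_pos_of_eq rfl)
    (decide_pos_of_eq' ht rfl) (decide_pos_of_eq rfl) (decide_pos_of_eq' ht rfl)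
    (fun h => by
      rw [← decide_pos_of_eq' htp rfl h, ← decide_pos_neg
        (by convert neg_ne_zero.2 hxm using 1; ring)]
      congr 2; ring)
    (decide_pos_of_eq (by ring)) (decide_pos_of_eq (by ring))
    (fun h => by
      rw [← decide_pos_of_eq' htm rfl h, ← decide_pos_neg
        (by convert neg_ne_zero.2 hxm using 1; ring)]
      congr 2; ring)
  have hσ : ∀ k, ![decide (0 < x), decide (0 < s + t), decide (0 < s - t), !decide (0 < x - s),
      decide (0 < x + t), decide (0 < x - t), !decide (0 < x + s), decide (0 < x - s),
      decide (0 < t), !decide (0 < t), decide (0 < x + s), decide (0 < s)] k =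
      decide (0 < facetForm k (x, s, t)) := by
    -- Forms 3, 6 and 9 are written as literal negatives of forms 7, 10 and 8, so both sides now
    -- agree definitionally.
    rw [← decide_pos_neg ht, ← decide_pos_neg hxm, ← decide_pos_neg hxp]
    intro k
    fin_cases k <;> rfl
  have hneg : ∀ k, facetForm k (x, s, t) ≤ 0 ↔ facetForm k (x, s, t) < 0 := fun k =>
    ⟨fun h => lt_of_le_of_ne h (hp k), le_of_lt⟩
  simp only [hσ, decide_eq_true_eq, decide_eq_false_iff_not, not_lt, hneg] at h
  rw [← h, ← ncard_coe_finset]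
  congr 1
  ext i
  simp

/-- The linear part of a facet functional. -/
def facetMap (k : Fin 12) : ℝ × ℝ × ℝ →ₗ[ℝ] ℝ where
  toFun := facetForm k
  map_add' p q := by fin_cases k <;> simp [facetForm] <;> ring
  map_smul' r p := by fin_cases k <;> simp [facetForm] <;> ring

/-- The facets and vertices of an affine image of the truncated cupola. -/
noncomputable def StrictlyAdmissible.system {Q : CutOffsets} (h : Q.StrictlyAdmissible)
    (ψ : (ℝ × ℝ × ℝ) ≃ᵃ[ℝ] E3) : FacetVertexSystem (Fin 12) (Fin 20) where
  g k := ((facetMap k).toAffineMap - AffineMap.const ℝ _ (Q.facetValue k)).comp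
    (ψ.symm : E3 →ᵃ[ℝ] ℝ × ℝ × ℝ)
  v i := ψ (Q.vertex i)
  inc := facetsAt
  g_eq i k hk := by simpa [sub_eq_zero] using! Q.facetForm_vertex_eq i k hk
  g_neg i k hk := by simpa using! h.facetForm_vertex_lt i k hk
  hull x hx := by
    have hmem : ψ.symm x ∈ convexHull ℝ (range Q.vertex) :=
      Q.model_subset fun k => by simpa using! hx k
    have := mem_image_of_mem ψ hmem
    rw [AffineEquiv.apply_symm_apply] at this
    have h2 := (ψ : (ℝ × ℝ × ℝ) →ᵃ[ℝ] E3).image_convexHull (range Q.vertex)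
    rw [← range_comp] at h2
    exact h2.subset this
  inc_not_subset := by decide +kernel
  exists_mem_inc := by decide +kernel
  exists_notMem_inc := by decide +kernel
  exists_mem_notMem_inc := by decide +kernel

theorem StrictlyAdmissible.isEquiprojective_image {Q : CutOffsets} (h : Q.StrictlyAdmissible)
    (ψ : (ℝ × ℝ × ℝ) ≃ᵃ[ℝ] E3) : IsEquiprojective 11 (ψ '' Q.model) := by
  have hs : ψ '' Q.model = (h.system ψ).solid := by
    ext x
    constructor
    · rintro ⟨p, hp, rfl⟩ k
      simpa [system] using! hp k
    · intro hx
      exact ⟨ψ.symm x, fun k => by simpa [system] using! hx k, by simp⟩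
  rw [hs]
  refine (h.system ψ).isEquiprojective fun u hu => ?_
  have hlin : ∀ k, ((h.system ψ).g k).linear u = facetForm k (ψ.symm.linear u) := fun k => by
    simp [system]; rfl
  simp only [hlin] at hu
  simp only [FacetVertexSystem.Mixed, hlin]
  exact card_mixed hu

end CutOffsets

/-! ### The fourth cut: the section determines the plane -/

namespace CutOffsets

theorem convex_model (Q : CutOffsets) : Convex ℝ Q.model := by
  have : Q.model = ⋂ k, facetMap k ⁻¹' Iic (Q.facetValue k) := by
    ext p
    simp only [mem_iInter, mem_preimage, mem_Iic]
    rfl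
  rw [this]
  exact convex_iInter fun k => (convex_Iic _).linear_preimage _

theorem facetForm_add_smul (k : Fin 12) (p v : ℝ × ℝ × ℝ) (r : ℝ) :
    facetForm k (p + r • v) = facetForm k p + r * facetForm k v := by
  have h := (facetMap k).map_add p (r • v)
  rwa [map_smul] at h

/-- If a plane section of the truncated cupola is a parallelogram and avoids all facets but those in
`T`, then each of its sides lies in a facet of `T`. -/
theorem exists_facet_of_side {Q : CutOffsets} {h : ℝ × ℝ × ℝ →ₗ[ℝ] ℝ} {δ : ℝ}
    {P V W : ℝ × ℝ × ℝ} {T : Finset (Fin 12)}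
    (hR : ∀ p, (p ∈ Q.model ∧ h p = δ) ↔
      ∃ a b : ℝ, 0 ≤ a ∧ a ≤ 1 ∧ 0 ≤ b ∧ b ≤ 1 ∧ p = P + a • V + b • W)
    (hT : ∀ p ∈ Q.model, h p = δ → ∀ k ∉ T, facetForm k p < Q.facetValue k)
    (hVW : ∀ a b : ℝ, a • V + b • W = 0 → a = 0 ∧ b = 0) :
    ∃ k ∈ T, facetForm k V = 0 ∧ facetForm k W < 0 := by
  -- Otherwise the midpoint of the side from P to P + V could be pushed by -r W within the section,
  -- out of the parallelogram.
  by_contra! hcon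
  obtain ⟨hP, hhP⟩ := (hR P).2 ⟨0, 0, by simp⟩
  obtain ⟨hPV, hhPV⟩ := (hR (P + V)).2 ⟨1, 0, by simp⟩
  obtain ⟨hPW, hhPW⟩ := (hR (P + W)).2 ⟨0, 1, by simp⟩
  obtain ⟨hq, hhq⟩ := (hR (P + (1 / 2 : ℝ) • V)).2 ⟨1 / 2, 0, by norm_num⟩
  rw [map_add, hhP] at hhPW
  have hW : h W = 0 := by linarith
  have hev : ∀ᶠ r in nhdsWithin (0 : ℝ) (Ioi 0),
      ∀ k, facetForm k (P + (1 / 2 : ℝ) • V + (-r) • W) ≤ Q.facetValue k := by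
    refine Filter.eventually_all.2 fun k => ?_
    simp only [facetForm_add_smul k (P + (1 / 2 : ℝ) • V)]
    rcases (hq k).lt_or_eq with hlt | heq
    · have hc : Continuous fun r : ℝ =>
          facetForm k (P + (1 / 2 : ℝ) • V) + -r * facetForm k W := by fun_prop
      have : ∀ᶠ r in nhds (0 : ℝ), facetForm k (P + (1 / 2 : ℝ) • V) + -r * facetForm k W <
          Q.facetValue k :=
        hc.continuousAt.eventually (p := fun y => y < Q.facetValue k)
          (gt_mem_nhds (by simpa using hlt))
      exact (this.mono fun r hr => hr.le).filter_mono nhdsWithin_le_nhds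
    · have hk : k ∈ T := by
        by_contra hk
        exact (hT _ hq hhq k hk).ne heq
      have h1 := hP k
      have h2 := hPV k
      have h3 := facetForm_add_smul k P V (1 / 2)
      have h4 := facetForm_add_smul k P V 1
      rw [one_smul] at h4
      -- A facet through the midpoint contains both ends of the side, so its form vanishes on V.
      have h5 := hcon k hk (by linarith)
      filter_upwards [self_mem_nhdsWithin] with r hr
      have := mul_nonneg (le_of_lt hr) h5
      linarith
  obtain ⟨r, hr, hr0⟩ := (hev.and self_mem_nhdsWithin).exists
  obtain ⟨a, b, -, -, hb, -, heq⟩ := (hR _).1 ⟨hr, by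
    rw [map_add, map_smul, hhq, hW, smul_zero, add_zero]⟩
  have h0 : (1 / 2 - a) • V + (-r - b) • W = 0 := by
    have := sub_eq_zero.2 heq
    rw [← this]; module
  have := (hVW _ _ h0).2
  have hr0' : 0 < r := hr0
  linarith

/-- For these offsets the listed vertices collapse to the eight cupola vertices other than (0, 2,
0), so the part s ≤ 1 of the cupola is their hull. -/
theorem lt_of_mem_model_of_le_one {α β γ δ : ℝ} (h1 : α + β - γ < δ) (h2 : α + β + γ < δ)
    (h3 : α - β - γ < δ) (h4 : α - β + γ < δ) (h5 : 2 * γ < δ) (h6 : -α + β + γ < δ)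
    (h7 : -α + β - γ < δ) (h8 : -2 * γ < δ) {p : ℝ × ℝ × ℝ}
    (hp : p ∈ (CutOffsets.mk 2 2 2 2 1).model) :
    α * p.1 + β * p.2.1 + γ * p.2.2 < δ := by
  have hc : Convex ℝ {p : ℝ × ℝ × ℝ | α * p.1 + β * p.2.1 + γ * p.2.2 < δ} :=
    convex_halfSpace_lt ⟨fun p q => by simp; ring, fun r p => by simp; ring⟩ δ
  refine convexHull_min (range_subset_iff.2 fun i => ?_) hc (model_subset _ hp)
  show α * (vertex _ i).1 + β * (vertex _ i).2.1 + γ * (vertex _ i).2.2 < δ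
  fin_cases i <;> norm_num [vertex] <;> linarith

/-- The signs on W force i ≠ j. Facets 1 and 2 share the x-direction, facets 3 and 10 the
t-direction; any other pair shares the direction of a cupola edge at (0, 2, 0), and the four
inequalities say that the plane is transversal to these edges. -/
theorem direction_of_two_facets {α β γ : ℝ} (h1 : 0 < β + α + γ) (h2 : 0 < β + α - γ)
    (h3 : 0 < β - α + γ) (h4 : 0 < β - α - γ) {V W : ℝ × ℝ × ℝ}
    (hV : α * V.1 + β * V.2.1 + γ * V.2.2 = 0) {i j : Fin 12}
    (hi : i ∈ ({1, 2, 3, 10} : Finset (Fin 12))) (hj : j ∈ ({1, 2, 3, 10} : Finset (Fin 12)))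
    (hiV : facetForm i V = 0) (hjV : facetForm j V = 0) (hiW : facetForm i W < 0)
    (hjW : 0 < facetForm j W) : (V.2.1 = 0 ∧ V.2.2 = 0) ∨ (V.1 = 0 ∧ V.2.1 = 0) := by
  obtain ⟨x, s, t⟩ := V
  have key : ∀ {r y : ℝ}, 0 < r → r * y = 0 → y = 0 := fun hr h =>
    (mul_eq_zero.1 h).resolve_left hr.ne'
  have c12 : s + t = 0 → s - t = 0 → (s = 0 ∧ t = 0) ∨ (x = 0 ∧ s = 0) := fun e1 e2 =>
    Or.inl ⟨by linarith, by linarith⟩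
  have c3 : -(x - s) = 0 → x + s = 0 → (s = 0 ∧ t = 0) ∨ (x = 0 ∧ s = 0) := fun e1 e2 =>
    Or.inr ⟨by linarith, by linarith⟩
  have c13 : s + t = 0 → -(x - s) = 0 → (s = 0 ∧ t = 0) ∨ (x = 0 ∧ s = 0) := fun e1 e2 => by
    have e : s = 0 := key h2 (by
      rw [← hV, show x = s by linarith, show t = -s by linarith]; ring)
    exact Or.inl ⟨e, by linarith⟩
  have c23 : s - t = 0 → -(x - s) = 0 → (s = 0 ∧ t = 0) ∨ (x = 0 ∧ s = 0) := fun e1 e2 => by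
    have e : s = 0 := key h1 (by
      rw [← hV, show x = s by linarith, show t = s by linarith]; ring)
    exact Or.inl ⟨e, by linarith⟩
  have c14 : s + t = 0 → x + s = 0 → (s = 0 ∧ t = 0) ∨ (x = 0 ∧ s = 0) := fun e1 e2 => by
    have e : s = 0 := key h4 (by
      rw [← hV, show x = -s by linarith, show t = -s by linarith]; ring)
    exact Or.inl ⟨e, by linarith⟩
  have c24 : s - t = 0 → x + s = 0 → (s = 0 ∧ t = 0) ∨ (x = 0 ∧ s = 0) := fun e1 e2 => by
    have e : s = 0 := key h3 (by
      rw [← hV, show x = -s by linarith, show t = s by linarith]; ring)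
    exact Or.inl ⟨e, by linarith⟩
  have f1 : facetForm 1 (x, s, t) = s + t := rfl
  have f2 : facetForm 2 (x, s, t) = s - t := rfl
  have f3 : facetForm 3 (x, s, t) = -(x - s) := rfl
  have f4 : facetForm 10 (x, s, t) = x + s := rfl
  simp only [Finset.mem_insert, Finset.mem_singleton] at hi hj
  rcases hi with rfl | rfl | rfl | rfl <;> rcases hj with rfl | rfl | rfl | rfl <;>
    first
    | exact absurd hiW hjW.le.not_gt
    | skip
  all_goals
    simp only [f1, f2, f3, f4] at hiV hjV
    first
    | exact c12 hiV hjV | exact c12 hjV hiV | exact c13 hiV hjV | exact c13 hjV hiV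
    | exact c14 hiV hjV | exact c14 hjV hiV | exact c23 hiV hjV | exact c23 hjV hiV
    | exact c24 hiV hjV | exact c24 hjV hiV | exact c3 hiV hjV | exact c3 hjV hiV

/-- A plane that separates the vertex `(0, 2, 0)` of the cupola from the others and cuts the truncated
cupola in a parallelogram is orthogonal to the axis of the middle coordinate. -/
theorem plane_of_parallelogram {c d d' e α β γ δ : ℝ} (hc : 0 < c) (hd : 1 < d)
    (hd' : 1 < d') (he2 : e < 2)
    (h0 : δ < 2 * β) (h1 : α + β - γ < δ) (h2 : α + β + γ < δ)
    (h3 : α - β - γ < δ) (h4 : α - β + γ < δ) (h5 : 2 * γ < δ) (h6 : -α + β + γ < δ)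
    (h7 : -α + β - γ < δ) (h8 : -2 * γ < δ) {P V W : ℝ × ℝ × ℝ}
    (hR : ∀ p : ℝ × ℝ × ℝ, (p ∈ (CutOffsets.mk c d d' e 2).model ∧
        α * p.1 + β * p.2.1 + γ * p.2.2 = δ) ↔
      ∃ a b : ℝ, 0 ≤ a ∧ a ≤ 1 ∧ 0 ≤ b ∧ b ≤ 1 ∧ p = P + a • V + b • W)
    (hVW : ∀ a b : ℝ, a • V + b • W = 0 → a = 0 ∧ b = 0) :
    α = 0 ∧ γ = 0 ∧ 0 < β ∧ β < δ ∧ δ < β * (1 + e / 2) := by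
  let h : ℝ × ℝ × ℝ →ₗ[ℝ] ℝ := IsLinearMap.mk' (fun p => α * p.1 + β * p.2.1 + γ * p.2.2)
    ⟨fun p q => by simp; ring, fun r p => by simp; ring⟩
  have hT : ∀ p ∈ (CutOffsets.mk c d d' e 2).model, h p = δ →
      ∀ k ∉ ({1, 2, 3, 10} : Finset (Fin 12)),
        facetForm k p < (CutOffsets.mk c d d' e 2).facetValue k := by
    rintro ⟨x, s, t⟩ hp hhp
    obtain ⟨m1, m2, m3, m4, m5, m6, m7, m8, m9, m10, m11, m12⟩ := (mem_model _).1 hp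
    simp only at m8 m9 m10 m11 m12
    -- The plane misses the part s ≤ 1, and where s > 1 only facets 1, 2, 3 and 10 can be reached.
    have hs : 1 < s := by
      by_contra! hs
      have hm : (x, s, t) ∈ (CutOffsets.mk 2 2 2 2 1).model :=
        (mem_model _).2 ⟨m1, m2, m3, m4, m5, m6, m7, by simp; linarith, by simp; linarith,
          by simp; linarith, by simp; linarith, hs⟩
      exact (lt_of_mem_model_of_le_one h1 h2 h3 h4 h5 h6 h7 h8 hm).ne hhp
    intro k hk
    fin_cases k <;> simp [facetForm, facetValue] at hk ⊢ <;> linarith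
  have hR' : ∀ p, (p ∈ (CutOffsets.mk c d d' e 2).model ∧ h p = δ) ↔ _ := hR
  have hV : h V = 0 := by
    have e1 := ((hR P).2 ⟨0, 0, by simp⟩).2
    have e2 := ((hR (P + V)).2 ⟨1, 0, by simp⟩).2
    have e3 := h.map_add P V
    have e4 : h P = δ := e1
    have e5 : h (P + V) = δ := e2
    linarith
  have hW : h W = 0 := by
    have e1 := ((hR P).2 ⟨0, 0, by simp⟩).2
    have e2 := ((hR (P + W)).2 ⟨0, 1, by simp⟩).2
    have e3 := h.map_add P W
    have e4 : h P = δ := e1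
    have e5 : h (P + W) = δ := e2
    linarith
  have hneg : ∀ (k : Fin 12) (U : ℝ × ℝ × ℝ), facetForm k (-U) = -facetForm k U := fun k U =>
    (facetMap k).map_neg U
  obtain ⟨i, hi, hiV, hiW⟩ := exists_facet_of_side hR' hT hVW
  obtain ⟨j, hj, hjV, hjW⟩ := exists_facet_of_side (P := P + W) (V := V) (W := -W)
    (fun p => (hR' p).trans ⟨fun ⟨a, b, ha, ha', hb, hb', hp⟩ =>
      ⟨a, 1 - b, ha, ha', by linarith, by linarith, by rw [hp]; module⟩,
      fun ⟨a, b, ha, ha', hb, hb', hp⟩ =>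
      ⟨a, 1 - b, ha, ha', by linarith, by linarith, by rw [hp]; module⟩⟩) hT
    (fun a b hab => by simpa using hVW a (-b) (by rw [← hab]; module))
  obtain ⟨k, hk, hkW, hkV⟩ := exists_facet_of_side (P := P) (V := W) (W := V)
    (fun p => (hR' p).trans ⟨fun ⟨a, b, ha, ha', hb, hb', hp⟩ =>
      ⟨b, a, hb, hb', ha, ha', by rw [hp]; module⟩,
      fun ⟨a, b, ha, ha', hb, hb', hp⟩ =>
      ⟨b, a, hb, hb', ha, ha', by rw [hp]; module⟩⟩) hT
    (fun a b hab => (hVW b a (by rw [← hab]; module)).symm)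
  obtain ⟨l, hl, hlW, hlV⟩ := exists_facet_of_side (P := P + V) (V := W) (W := -V)
    (fun p => (hR' p).trans ⟨fun ⟨a, b, ha, ha', hb, hb', hp⟩ =>
      ⟨b, 1 - a, hb, hb', by linarith, by linarith, by rw [hp]; module⟩,
      fun ⟨a, b, ha, ha', hb, hb', hp⟩ =>
      ⟨1 - b, a, by linarith, by linarith, ha, ha', by rw [hp]; module⟩⟩) hT
    (fun a b hab => by
      have := hVW (-b) a (by rw [← hab]; module)
      exact ⟨this.2, by simpa using this.1⟩)
  rw [hneg] at hjW hlV
  have dV := direction_of_two_facets (α := α) (β := β) (γ := γ) (by linarith) (by linarith)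
    (by linarith) (by linarith) hV hi hj hiV hjV hiW (by linarith)
  have dW := direction_of_two_facets (α := α) (β := β) (γ := γ) (by linarith) (by linarith)
    (by linarith) (by linarith) hW hk hl hkW hlW hkV (by linarith)
  have mP := (hR P).2 ⟨0, 0, by simp⟩
  have mV := (hR (P + V)).2 ⟨1, 0, by simp⟩
  have mW := (hR (P + W)).2 ⟨0, 1, by simp⟩
  obtain ⟨x, s, t⟩ := P
  obtain ⟨v₁, v₂, v₃⟩ := V
  obtain ⟨w₁, w₂, w₃⟩ := W
  have hV' : α * v₁ + β * v₂ + γ * v₃ = 0 := hV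
  have hW' : α * w₁ + β * w₂ + γ * w₃ = 0 := hW
  simp only [Prod.mk_add_mk, mem_model] at mP mV mW
  obtain ⟨⟨-, -, -, p1, -, -, -, -, -, -, p2, -⟩, p3⟩ := mP
  obtain ⟨⟨-, -, -, q1, -, -, -, -, -, -, q2, -⟩, -⟩ := mV
  obtain ⟨⟨-, -, -, r1, -, -, -, -, -, -, r2, -⟩, -⟩ := mW
  simp only at dV dW p3
  have hβ : 0 < β := by linarith
  -- Adding s - x ≤ 2 and x + s ≤ e gives s ≤ 1 + e / 2, with equality for a single x; the section
  -- has two points with equal s and different x.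
  have fin : ∀ u : ℝ, u ≠ 0 → s - (x + u) ≤ 2 → x + u + s ≤ e → s < 1 + e / 2 := by
    intro u hu e1 e2
    rcases lt_or_gt_of_ne hu with h | h <;> linarith
  have concl : α = 0 → γ = 0 → s < 1 + e / 2 →
      α = 0 ∧ γ = 0 ∧ 0 < β ∧ β < δ ∧ δ < β * (1 + e / 2) := fun e1 e2 e3 =>
    ⟨e1, e2, hβ, by linarith, by
      rw [← p3, e1, e2]; linarith [mul_lt_mul_of_pos_left e3 hβ]⟩
  rcases dV with ⟨rfl, rfl⟩ | ⟨rfl, rfl⟩ <;> rcases dW with ⟨rfl, rfl⟩ | ⟨rfl, rfl⟩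
  · have := hVW w₁ (-v₁) (by simp; ring)
    have h' := hVW 1 0 (by simp; linarith [this.2])
    norm_num at h'
  · have hv : v₁ ≠ 0 := by rintro rfl; have h' := hVW 1 0 (by simp); norm_num at h'
    have hw : w₃ ≠ 0 := by rintro rfl; have h' := hVW 0 1 (by simp); norm_num at h'
    simp only [mul_zero, add_zero, zero_add, mul_eq_zero, hv, hw, or_false] at hV' hW'
    exact concl hV' hW' (fin v₁ hv (by linarith) (by linarith))
  · have hv : w₁ ≠ 0 := by rintro rfl; have h' := hVW 0 1 (by simp); norm_num at h'
    have hw : v₃ ≠ 0 := by rintro rfl; have h' := hVW 1 0 (by simp); norm_num at h'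
    simp only [mul_zero, add_zero, zero_add, mul_eq_zero, hv, hw, or_false] at hV' hW'
    exact concl hW' hV' (fin w₁ hv (by linarith) (by linarith))
  · have := hVW w₃ (-v₃) (by simp; ring)
    have h' := hVW 1 0 (by simp; linarith [this.2])
    norm_num at h'

end CutOffsets

/-! ### Coordinates adapted to a triangular cupola -/

/-- A similarity of Euclidean space is affine and preserves orthogonality. -/
theorem DilationEquiv.exists_affineEquiv (f : E3 ≃ᵈ E3) :
    ∃ F : E3 ≃ᵃ[ℝ] E3, (∀ x, F x = f x) ∧
      ∀ u v : E3, inner ℝ u v = 0 → inner ℝ (F.linear u) (F.linear v) = 0 := by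
  have hr : (Dilation.ratio f : ℝ) ≠ 0 := NNReal.coe_ne_zero.2 (Dilation.ratio_ne_zero f)
  set r : ℝ := (Dilation.ratio f : ℝ)
  -- Divided by its ratio, f is a surjective isometry, hence affine by Mazur–Ulam.
  have hiso : Isometry fun x => r⁻¹ • f x := Isometry.of_dist_eq fun x y => by
    have hd : dist (f x) (f y) = r * dist x y := Dilation.dist_eq f x y
    rw [dist_smul₀, hd, norm_inv, Real.norm_of_nonneg (NNReal.coe_nonneg _)]
    exact inv_mul_cancel_left₀ hr _
  let A : E3 ≃ᵢ E3 := ⟨f.toEquiv.trans (LinearEquiv.smulOfNeZero ℝ E3 r⁻¹ (inv_ne_zero hr)).toEquiv,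
    hiso⟩
  let B := A.toRealAffineIsometryEquiv
  refine ⟨B.toAffineEquiv.trans (LinearEquiv.smulOfNeZero ℝ E3 r hr).toAffineEquiv, fun x => ?_,
    fun u v huv => ?_⟩
  · have hB : B x = r⁻¹ • f x := rfl
    show r • B x = f x
    rw [hB, smul_inv_smul₀ hr]
  · show inner ℝ (r • B.linearIsometryEquiv u) (r • B.linearIsometryEquiv v) = (0 : ℝ)
    rw [inner_smul_left, inner_smul_right, LinearIsometryEquiv.inner_map_map, huv]
    simp

/-- The coordinates `(x, y + z, y - z)` on Euclidean space. -/
noncomputable def adaptedCoord : (ℝ × ℝ × ℝ) ≃ₗ[ℝ] E3 where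
  toFun p := !₂[p.1, (p.2.1 + p.2.2) / 2, (p.2.1 - p.2.2) / 2]
  invFun x := (x 0, x 1 + x 2, x 1 - x 2)
  map_add' p q := by ext i; fin_cases i <;> simp <;> ring
  map_smul' r p := by ext i; fin_cases i <;> simp <;> ring
  left_inv p := by ext <;> simp <;> ring
  right_inv x := by ext i; fin_cases i <;> simp

/-- The top triangle of the cupola in adapted coordinates. -/
def topCoord : Fin 3 → ℝ × ℝ × ℝ := ![(0, 2, 0), (1, 1, -1), (1, 1, 1)]

/-- The base hexagon of the cupola in adapted coordinates. -/
def baseCoord : Fin 6 → ℝ × ℝ × ℝ :=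
  ![(1, -1, -1), (1, -1, 1), (0, 0, 2), (-1, 1, 1), (-1, 1, -1), (0, 0, -2)]

theorem adaptedCoord_topCoord (i : Fin 3) : adaptedCoord (topCoord i) = cupolaTop i := by
  ext j
  fin_cases i <;> fin_cases j <;> norm_num [adaptedCoord, topCoord, cupolaTop]

theorem adaptedCoord_baseCoord (i : Fin 6) : adaptedCoord (baseCoord i) = cupolaBase i := by
  ext j
  fin_cases i <;> fin_cases j <;> norm_num [adaptedCoord, baseCoord, cupolaBase]

theorem inner_adaptedCoord (p q : ℝ × ℝ × ℝ) : inner ℝ (adaptedCoord p) (adaptedCoord q) =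
    p.1 * q.1 + (p.2.1 * q.2.1 + p.2.2 * q.2.2) / 2 := by
  simp [adaptedCoord, PiLp.inner_apply, Fin.sum_univ_three]
  ring

theorem inner_eq_zero_of_mem_vectorSpan {s : Set E3} {w n : E3}
    (h : ∀ x ∈ s, ∀ y ∈ s, inner ℝ w (x - y) = 0) (hn : n ∈ vectorSpan ℝ s) :
    inner ℝ n w = 0 := by
  have hle : vectorSpan ℝ s ≤ (Submodule.span ℝ {w})ᗮ := by
    rw [vectorSpan_def, Submodule.span_le]
    rintro _ ⟨x, hx, y, hy, rfl⟩
    exact Submodule.mem_orthogonal_singleton_iff_inner_right.2 (h x hx y hy)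
  exact Submodule.mem_orthogonal_singleton_iff_inner_left.1 (hle hn)

namespace TriangularCupola

/-- The vectors (1, 2, 0) and (-1, 2, 0) are the adapted coordinates of (1, 1, 1) and (-1, 1, 1),
the normals of the base and of t₁ in the model. -/
theorem exists_coord (C : TriangularCupola) : ∃ ψ : (ℝ × ℝ × ℝ) ≃ᵃ[ℝ] E3,
    (∀ i, C.a i = ψ (topCoord i)) ∧ (∀ i, C.b i = ψ (baseCoord i)) ∧
      (∀ n ∈ C.baseDirection, inner ℝ n (ψ.linear (1, 2, 0)) = 0) ∧
        ∀ n ∈ C.t₁Direction, inner ℝ n (ψ.linear (-1, 2, 0)) = 0 := by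
  obtain ⟨f, ha, hb⟩ := C.similar_model
  obtain ⟨F, hF, hinner⟩ := f.exists_affineEquiv
  let ψ := adaptedCoord.toAffineEquiv.trans F
  have hψ : ∀ p, ψ p = f (adaptedCoord p) := fun p => hF _
  have hψl : ∀ p q : ℝ × ℝ × ℝ, p.1 * q.1 + (p.2.1 * q.2.1 + p.2.2 * q.2.2) / 2 = 0 →
      inner ℝ (ψ.linear p) (ψ.linear q) = 0 := fun p q h =>
    hinner _ _ (by rw [← h]; exact inner_adaptedCoord p q)
  have ha' : ∀ i, C.a i = ψ (topCoord i) := fun i => by rw [hψ, adaptedCoord_topCoord, ha]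
  have hb' : ∀ i, C.b i = ψ (baseCoord i) := fun i => by rw [hψ, adaptedCoord_baseCoord, hb]
  have hsub : ∀ p q, ψ p - ψ q = ψ.linear (p - q) := fun p q =>
    ((ψ : (ℝ × ℝ × ℝ) →ᵃ[ℝ] E3).linearMap_vsub p q).symm
  refine ⟨ψ, ha', hb', fun n hn => ?_, fun n hn => ?_⟩
  · refine inner_eq_zero_of_mem_vectorSpan ?_ hn
    rintro _ ⟨i, rfl⟩ _ ⟨j, rfl⟩
    rw [hb', hb', hsub]
    apply hψl
    fin_cases i <;> fin_cases j <;> norm_num [baseCoord]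
  · refine inner_eq_zero_of_mem_vectorSpan ?_ hn
    have : ∀ x ∈ ({C.a 0, C.b 3, C.b 4} : Set E3), ∃ p : ℝ × ℝ × ℝ, x = ψ p ∧
        -p.1 + p.2.1 = 2 := by
      rintro _ (rfl | rfl | rfl)
      · exact ⟨_, ha' 0, by norm_num [topCoord]⟩
      · exact ⟨_, hb' 3, show -(-1 : ℝ) + 1 = 2 by norm_num⟩
      · exact ⟨_, hb' 4, show -(-1 : ℝ) + 1 = 2 by norm_num⟩
    intro x hx y hy
    obtain ⟨p, rfl, hp⟩ := this x hx
    obtain ⟨q, rfl, hq⟩ := this y hy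
    rw [hsub]
    apply hψl
    simp
    linarith

/-- With all offsets 2 the cuts remove nothing (x + s ≤ 2 is the top face), and the twenty listed
vertices collapse onto the nine of the cupola. -/
theorem model_eq_convexHull : (CutOffsets.mk 2 2 2 2 2).model =
    convexHull ℝ (range topCoord ∪ range baseCoord) := by
  apply Subset.antisymm
  · refine (CutOffsets.model_subset _).trans (convexHull_mono (range_subset_iff.2 fun i => ?_))
    have ht : ∀ j, topCoord j ∈ range topCoord ∪ range baseCoord := fun j => Or.inl ⟨j, rfl⟩
    have hb : ∀ j, baseCoord j ∈ range topCoord ∪ range baseCoord := fun j => Or.inr ⟨j, rfl⟩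
    generalize range topCoord ∪ range baseCoord = R at ht hb ⊢
    let j : Fin 20 → ℝ × ℝ × ℝ := ![baseCoord 2, topCoord 2, topCoord 0, topCoord 0, baseCoord 3,
      baseCoord 2, topCoord 2, baseCoord 1, baseCoord 1, baseCoord 2, baseCoord 5, topCoord 1,
      topCoord 0, topCoord 0, baseCoord 4, baseCoord 5, topCoord 1, baseCoord 0, baseCoord 0,
      baseCoord 5]
    have hj : CutOffsets.vertex ⟨2, 2, 2, 2, 2⟩ i = j i := by
      fin_cases i <;> norm_num [CutOffsets.vertex, j, topCoord, baseCoord] <;> rfl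
    rw [hj]
    fin_cases i
    exacts [hb 2, ht 2, ht 0, ht 0, hb 3, hb 2, ht 2, hb 1, hb 1, hb 2, hb 5, ht 1, ht 0, ht 0, hb 4,
      hb 5, ht 1, hb 0, hb 0, hb 5]
  · refine convexHull_min (union_subset (range_subset_iff.2 fun i => ?_)
      (range_subset_iff.2 fun i => ?_)) (CutOffsets.convex_model _)
    · fin_cases i <;> refine (CutOffsets.mem_model _).2 ?_ <;> norm_num
    · fin_cases i <;> refine (CutOffsets.mem_model _).2 ?_ <;> norm_num

theorem solid_eq_image {C : TriangularCupola} {ψ : (ℝ × ℝ × ℝ) ≃ᵃ[ℝ] E3}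
    (ha : ∀ i, C.a i = ψ (topCoord i)) (hb : ∀ i, C.b i = ψ (baseCoord i)) :
    C.solid = ψ '' (CutOffsets.mk 2 2 2 2 2).model := by
  have h := (ψ : (ℝ × ℝ × ℝ) →ᵃ[ℝ] E3).image_convexHull (range topCoord ∪ range baseCoord)
  rw [model_eq_convexHull]
  refine Eq.trans ?_ h.symm
  rw [image_union, ← range_comp, ← range_comp, solid]
  congr 2
  · exact congrArg range (funext ha)
  · exact congrArg range (funext hb)

end TriangularCupola

/-! ### Normal form of the five cuts -/

theorem HalfSpace.exists_coeffs (H : HalfSpace) (ψ : (ℝ × ℝ × ℝ) ≃ᵃ[ℝ] E3) :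
    ∃ α β γ δ : ℝ, (∀ p, inner ℝ H.normal (ψ.linear p) = α * p.1 + β * p.2.1 + γ * p.2.2) ∧
      ∀ p, inner ℝ H.normal (ψ p) - H.offset = α * p.1 + β * p.2.1 + γ * p.2.2 - δ := by
  have hlin : ∀ p : ℝ × ℝ × ℝ, inner ℝ H.normal (ψ.linear p) =
      inner ℝ H.normal (ψ.linear (1, 0, 0)) * p.1 + inner ℝ H.normal (ψ.linear (0, 1, 0)) * p.2.1 +
        inner ℝ H.normal (ψ.linear (0, 0, 1)) * p.2.2 := fun p => by
    have hp : p = p.1 • (1, 0, 0) + p.2.1 • (0, 1, 0) + p.2.2 • (0, 0, 1) := by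
      ext <;> simp
    conv_lhs => rw [hp]
    simp only [map_add, map_smul, inner_add_right, inner_smul_right]
    ring
  refine ⟨_, _, _, H.offset - inner ℝ H.normal (ψ 0), hlin, fun p => ?_⟩
  have h := (ψ : (ℝ × ℝ × ℝ) →ᵃ[ℝ] E3).map_vadd 0 p
  have h' : ψ p = ψ.linear p + ψ 0 := by simpa using! h
  rw [← hlin, h', inner_add_right]
  ring

namespace TriangularCupola

theorem Equitruncation.exists_offsets {C : TriangularCupola} (K : C.Equitruncation) :
    ∃ (ψ : (ℝ × ℝ × ℝ) ≃ᵃ[ℝ] E3) (Q : CutOffsets),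
      Q.StrictlyAdmissible ∧ K.solid = ψ '' Q.model := by
  obtain ⟨ψ, ha, hb, hbase, ht₁⟩ := C.exists_coord
  have hsolid := solid_eq_image ha hb
  have a0 : C.a 0 = ψ (0, 2, 0) := ha 0
  have a1 : C.a 1 = ψ (1, 1, -1) := ha 1
  have a2 : C.a 2 = ψ (1, 1, 1) := ha 2
  have b0 : C.b 0 = ψ (1, -1, -1) := hb 0
  have b1 : C.b 1 = ψ (1, -1, 1) := hb 1
  have b2 : C.b 2 = ψ (0, 0, 2) := hb 2
  have b3 : C.b 3 = ψ (-1, 1, 1) := hb 3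
  have b4 : C.b 4 = ψ (-1, 1, -1) := hb 4
  have b5 : C.b 5 = ψ (0, 0, -2) := hb 5
  have hsub : ∀ p q, ψ.linear (p - q) = ψ p - ψ q := fun p q =>
    (ψ : (ℝ × ℝ × ℝ) →ᵃ[ℝ] E3).linearMap_vsub p q
  have horth : ∀ (H : HalfSpace) (v : E3), v ∈ H.direction → inner ℝ H.normal v = 0 :=
    fun H v hv => Submodule.mem_orthogonal_singleton_iff_inner_right.1 hv
  -- the first cut
  obtain ⟨c, hc0, hc2, hcut1, hplane1⟩ : ∃ c : ℝ, 0 < c ∧ c < 2 ∧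
      (∀ p : ℝ × ℝ × ℝ, ψ p ∈ K.cut1.carrier ↔ p.1 - p.2.1 ≤ c) ∧
        ∀ p : ℝ × ℝ × ℝ, p.1 - p.2.1 = c → ψ p ∈ K.cut1.plane := by
    obtain ⟨α, β, γ, δ, hl, h⟩ := K.cut1.exists_coeffs ψ
    have m3 : C.b 3 - C.a 0 ∈ K.cut1.direction := by
      rw [K.cut1_parallel]; exact vsub_mem_vectorSpan ℝ (by simp) (by simp)
    have m4 : C.b 4 - C.a 0 ∈ K.cut1.direction := by
      rw [K.cut1_parallel]; exact vsub_mem_vectorSpan ℝ (by simp) (by simp)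
    have e3 := horth _ _ m3
    have e4 := horth _ _ m4
    rw [b3, a0, ← hsub, hl] at e3
    rw [b4, a0, ← hsub, hl] at e4
    have k := K.cut1_edge₂
    rw [HalfSpace.Keeps, HalfSpace.Removes, a2, b1] at k
    have k1 := h (1, 1, 1)
    have k2 := h (1, -1, 1)
    norm_num at e3 e4 k1 k2
    have hγ : γ = 0 := by linarith
    have hβ : β = -α := by linarith
    subst hγ hβ
    have hα : 0 < α := by linarith [k.1, k.2]
    refine ⟨δ / α, div_pos (by linarith [k.1, k.2]) hα,
      (div_lt_iff₀ hα).2 (by linarith [k.1, k.2]), fun p => ?_, fun p hp => ?_⟩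
    · have hp := h p
      rw [le_div_iff₀ hα]
      show inner ℝ K.cut1.normal (ψ p) ≤ K.cut1.offset ↔ _
      constructor <;> intro <;> linarith
    · have hp' := h p
      rw [eq_div_iff hα.ne'] at hp
      show inner ℝ K.cut1.normal (ψ p) = K.cut1.offset
      linarith
  -- the second cuts
  obtain ⟨d, hd1, hd2, hcut2, hplane2⟩ : ∃ d : ℝ, 1 < d ∧ d < 2 ∧
      (∀ p : ℝ × ℝ × ℝ, ψ p ∈ K.cut2.carrier ↔ p.2.2 ≤ d) ∧
        ∀ p : ℝ × ℝ × ℝ, p.2.2 = d → ψ p ∈ K.cut2.plane := by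
    obtain ⟨α, β, γ, δ, hl, h⟩ := K.cut2.exists_coeffs ψ
    -- Orthogonality to the normals of the base and of t₁ gives α + 2β = 0 and -α + 2β = 0, so only
    -- the t-coefficient survives.
    have e3 := hbase _ K.cut2_perp.1
    have e4 := ht₁ _ K.cut2_perp.2
    rw [hl] at e3 e4
    have k := K.cut2_edge
    rw [HalfSpace.Keeps, HalfSpace.Removes, a2, b2] at k
    have k1 := h (1, 1, 1)
    have k2 := h (0, 0, 2)
    norm_num at e3 e4 k1 k2
    have hα : α = 0 := by linarith
    have hβ : β = 0 := by linarith
    subst hα hβ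
    have hγ : 0 < γ := by linarith [k.1, k.2]
    refine ⟨δ / γ, (lt_div_iff₀ hγ).2 (by linarith [k.1, k.2]),
      (div_lt_iff₀ hγ).2 (by linarith [k.1, k.2]), fun p => ?_, fun p hp => ?_⟩
    · have hp := h p
      rw [le_div_iff₀ hγ]
      show inner ℝ K.cut2.normal (ψ p) ≤ K.cut2.offset ↔ _
      constructor <;> intro <;> linarith
    · have hp' := h p
      rw [eq_div_iff hγ.ne'] at hp
      show inner ℝ K.cut2.normal (ψ p) = K.cut2.offset
      linarith
  obtain ⟨d', hd1', hd2', hcut2', hplane2'⟩ : ∃ d : ℝ, 1 < d ∧ d < 2 ∧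
      (∀ p : ℝ × ℝ × ℝ, ψ p ∈ K.cut2'.carrier ↔ -p.2.2 ≤ d) ∧
        ∀ p : ℝ × ℝ × ℝ, -p.2.2 = d → ψ p ∈ K.cut2'.plane := by
    obtain ⟨α, β, γ, δ, hl, h⟩ := K.cut2'.exists_coeffs ψ
    have e3 := hbase _ K.cut2'_perp.1
    have e4 := ht₁ _ K.cut2'_perp.2
    rw [hl] at e3 e4
    have k := K.cut2'_edge
    rw [HalfSpace.Keeps, HalfSpace.Removes, a1, b5] at k
    have k1 := h (1, 1, -1)
    have k2 := h (0, 0, -2)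
    norm_num at e3 e4 k1 k2
    have hα : α = 0 := by linarith
    have hβ : β = 0 := by linarith
    subst hα hβ
    have hγ : 0 < -γ := by linarith [k.1, k.2]
    refine ⟨δ / -γ, (lt_div_iff₀ hγ).2 (by linarith [k.1, k.2]),
      (div_lt_iff₀ hγ).2 (by linarith [k.1, k.2]), fun p => ?_, fun p hp => ?_⟩
    · have hp := h p
      rw [le_div_iff₀ hγ]
      show inner ℝ K.cut2'.normal (ψ p) ≤ K.cut2'.offset ↔ _
      constructor <;> intro <;> linarith
    · have hp' := h p
      rw [eq_div_iff hγ.ne'] at hp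
      show inner ℝ K.cut2'.normal (ψ p) = K.cut2'.offset
      linarith
  -- the third cut
  obtain ⟨e, he0, he2, hcut3, hplane3⟩ : ∃ e : ℝ, 0 < e ∧ e < 2 ∧
      (∀ p : ℝ × ℝ × ℝ, ψ p ∈ K.cut3.carrier ↔ p.1 + p.2.1 ≤ e) ∧
        ∀ p : ℝ × ℝ × ℝ, p.1 + p.2.1 = e → ψ p ∈ K.cut3.plane := by
    obtain ⟨α, β, γ, δ, hl, h⟩ := K.cut3.exists_coeffs ψ
    have m3 : C.b 3 - C.b 2 ∈ K.cut3.direction := by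
      rw [K.cut3_parallel]; exact vsub_mem_vectorSpan ℝ (by simp) (by simp)
    have m4 : C.b 4 - C.b 2 ∈ K.cut3.direction := by
      rw [K.cut3_parallel]; exact vsub_mem_vectorSpan ℝ (by simp) (by simp)
    have e3 := horth _ _ m3
    have e4 := horth _ _ m4
    rw [b3, b2, ← hsub, hl] at e3
    rw [b4, b2, ← hsub, hl] at e4
    have k := K.cut3_top.1 0
    have k' := K.cut3_top.2 2
    rw [HalfSpace.Removes, a0] at k
    rw [HalfSpace.Keeps, b2] at k'
    have k1 := h (0, 2, 0)
    have k2 := h (0, 0, 2)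
    norm_num at e3 e4 k1 k2
    have hγ : γ = 0 := by linarith
    have hβ : β = α := by linarith
    subst hγ hβ
    have hα : 0 < β := by linarith
    refine ⟨δ / β, div_pos (by linarith) hα, (div_lt_iff₀ hα).2 (by linarith),
      fun p => ?_, fun p hp => ?_⟩
    · have hp := h p
      rw [le_div_iff₀ hα]
      show inner ℝ K.cut3.normal (ψ p) ≤ K.cut3.offset ↔ _
      constructor <;> intro <;> linarith
    · have hp' := h p
      rw [eq_div_iff hα.ne'] at hp
      show inner ℝ K.cut3.normal (ψ p) = K.cut3.offset
      linarith
  -- the solid left by the first cuts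
  have hmemC : ∀ p, ψ p ∈ C.solid ↔ p ∈ (CutOffsets.mk 2 2 2 2 2).model := fun p => by
    rw [hsolid]; exact ψ.injective.mem_set_image
  have hmem : ∀ p, ψ p ∈ C.solid ∩ K.cut1.carrier ∩ K.cut2.carrier ∩ K.cut2'.carrier ∩
      K.cut3.carrier ↔ p ∈ (CutOffsets.mk c d d' e 2).model := by
    rintro ⟨x, s, t⟩
    simp only [mem_inter_iff, hmemC, hcut1, hcut2, hcut2', hcut3, CutOffsets.mem_model]
    constructor
    · rintro ⟨⟨⟨⟨⟨h1, h2, h3, h4, h5, h6, h7, h8, h9, h10, h11, h12⟩, k1⟩, k2⟩, k3⟩, k4⟩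
      exact ⟨h1, h2, h3, h4, h5, h6, h7, k1, k2, k3, k4, h12⟩
    · rintro ⟨h1, h2, h3, h4, h5, h6, h7, h8, h9, h10, h11, h12⟩
      exact ⟨⟨⟨⟨⟨h1, h2, h3, h4, h5, h6, h7, by linarith, by linarith, by linarith, by linarith,
        h12⟩, h8⟩, h9⟩, h10⟩, h11⟩
  -- the last cut
  obtain ⟨f, hf1, hf2, hcut4⟩ : ∃ f : ℝ, 1 < f ∧ f < 1 + e / 2 ∧
      ∀ p : ℝ × ℝ × ℝ, ψ p ∈ K.cut4.carrier ↔ p.2.1 ≤ f := by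
    obtain ⟨α, β, γ, δ, hl, h⟩ := K.cut4.exists_coeffs ψ
    obtain ⟨P, v, w, hv, hw, hvw, hrect⟩ := K.cut4_rectangle
    obtain ⟨kr, ka, kb⟩ := K.cut4_vertex
    simp only [HalfSpace.Keeps, HalfSpace.Removes] at kr ka kb
    have k0 := h (0, 2, 0)
    have k1 := h (1, 1, -1)
    have k2 := h (1, 1, 1)
    have k3 := h (1, -1, -1)
    have k4 := h (1, -1, 1)
    have k5 := h (0, 0, 2)
    have k6 := h (-1, 1, 1)
    have k7 := h (-1, 1, -1)
    have k8 := h (0, 0, -2)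
    rw [← a0] at k0
    rw [← a1] at k1
    rw [← a2] at k2
    rw [← b0] at k3
    rw [← b1] at k4
    rw [← b2] at k5
    rw [← b3] at k6
    rw [← b4] at k7
    rw [← b5] at k8
    simp only at k0 k1 k2 k3 k4 k5 k6 k7 k8
    have j1 := ka 1 (by decide)
    have j2 := ka 2 (by decide)
    have hψP : ∀ a b : ℝ, P + a • v + b • w =
        ψ (ψ.symm P + a • ψ.linear.symm v + b • ψ.linear.symm w) := fun a b => by
      have e1 := (ψ : (ℝ × ℝ × ℝ) →ᵃ[ℝ] E3).map_vadd (ψ.symm P)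
        (a • ψ.linear.symm v + b • ψ.linear.symm w)
      have e2 : ψ.linear (a • ψ.linear.symm v + b • ψ.linear.symm w) = a • v + b • w := by
        simp
      have e3 : ψ (a • ψ.linear.symm v + b • ψ.linear.symm w + ψ.symm P) =
          ψ.linear (a • ψ.linear.symm v + b • ψ.linear.symm w) + ψ (ψ.symm P) := e1
      rw [e2, ψ.apply_symm_apply] at e3
      rw [add_assoc, add_assoc, add_comm (ψ.symm P), e3, add_comm]
    obtain ⟨rfl, rfl, hβ, l1, l2⟩ := CutOffsets.plane_of_parallelogram (c := c) (d := d) (d' := d')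
      (e := e) (α := α) (β := β) (γ := γ) (δ := δ) (P := ψ.symm P) (V := ψ.linear.symm v)
      (W := ψ.linear.symm w) hc0 hd1 hd1' he2 (by linarith) (by linarith)
      (by linarith) (by linarith [kb 0]) (by linarith [kb 1]) (by linarith [kb 2])
      (by linarith [kb 3]) (by linarith [kb 4]) (by linarith [kb 5])
      (fun p => by
        have hp := h p
        have e1 : α * p.1 + β * p.2.1 + γ * p.2.2 = δ ↔ ψ p ∈ K.cut4.plane := by
          show _ ↔ inner ℝ K.cut4.normal (ψ p) = K.cut4.offset
          constructor <;> intro <;> linarith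
        rw [e1, ← hmem, ← mem_inter_iff, hrect]
        simp only [mem_ofPred_eq, hψP, ψ.injective.eq_iff])
      -- Orthogonality of the sides of the rectangle gives their linear independence.
      (fun a b hab => by
        have e1 : a • v + b • w = 0 := by
          have := congrArg ψ.linear hab
          simpa using this
        have e2 := congrArg (inner ℝ v) e1
        have e3 := congrArg (inner ℝ w) e1
        rw [inner_add_right, inner_smul_right, inner_smul_right, inner_zero_right] at e2 e3
        rw [hvw] at e2
        rw [real_inner_comm, hvw] at e3
        simpa [hv, hw] using And.intro e2 e3)
    refine ⟨δ / β, (lt_div_iff₀ hβ).2 (by linarith), (div_lt_iff₀ hβ).2 (by linarith),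
      fun p => ?_⟩
    have hp := h p
    rw [le_div_iff₀ hβ]
    show inner ℝ K.cut4.normal (ψ p) ≤ K.cut4.offset ↔ _
    constructor <;> intro <;> linarith
  refine ⟨ψ, ⟨c, d, d', e, f⟩, ⟨hd1, hd2, hd1', hd2', hc2, he2, ?_, ?_, ?_, ?_, ?_, hf1, hf2⟩, ?_⟩
  · by_contra! hle
    simp only at hle
    -- The planes of cut1 and cut2 and the face x + t = 2 meet here; if the inequality failed, this
    -- point would lie in both sections.
    have hC : ψ (2 - d, 2 - d - c, d) ∈ C.solid := (hmemC _).2 <| (CutOffsets.mem_model _).2 <| by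
      refine ⟨?_, ?_, ?_, ?_, ?_, ?_, ?_, ?_, ?_, ?_, ?_, ?_⟩ <;> (try simp only) <;> linarith
    exact disjoint_left.1 K.disjoint_cut1_cut2 ⟨hC, hplane1 _ (by simp)⟩ ⟨hC, hplane2 _ rfl⟩
  · by_contra! hle
    simp only at hle
    have hC : ψ (2 - d', 2 - d' - c, -d') ∈ C.solid :=
        (hmemC _).2 <| (CutOffsets.mem_model _).2 <| by
      refine ⟨?_, ?_, ?_, ?_, ?_, ?_, ?_, ?_, ?_, ?_, ?_, ?_⟩ <;> (try simp only) <;> linarith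
    exact disjoint_left.1 K.disjoint_cut1_cut2' ⟨hC, hplane1 _ (by simp)⟩
      ⟨hC, hplane2' _ (by simp)⟩
  · by_contra! hle
    simp only at hle
    have hC : ψ (2 - d, e - (2 - d), d) ∈ C.solid := (hmemC _).2 <| (CutOffsets.mem_model _).2 <| by
      refine ⟨?_, ?_, ?_, ?_, ?_, ?_, ?_, ?_, ?_, ?_, ?_, ?_⟩ <;> (try simp only) <;> linarith
    exact disjoint_left.1 K.disjoint_cut2_cut3 ⟨hC, hplane2 _ rfl⟩ ⟨hC, hplane3 _ (by simp)⟩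
  · by_contra! hle
    simp only at hle
    have hC : ψ (2 - d', e - (2 - d'), -d') ∈ C.solid :=
        (hmemC _).2 <| (CutOffsets.mem_model _).2 <| by
      refine ⟨?_, ?_, ?_, ?_, ?_, ?_, ?_, ?_, ?_, ?_, ?_, ?_⟩ <;> (try simp only) <;> linarith
    exact disjoint_left.1 K.disjoint_cut2'_cut3 ⟨hC, hplane2' _ (by simp)⟩
      ⟨hC, hplane3 _ (by simp)⟩
  · by_contra! hle
    simp only at hle
    -- The planes of cut1 and cut3 meet the symmetry plane t = 0 in this point.
    have hC : ψ ((c + e) / 2, (e - c) / 2, 0) ∈ C.solid :=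
        (hmemC _).2 <| (CutOffsets.mem_model _).2 <| by
      refine ⟨?_, ?_, ?_, ?_, ?_, ?_, ?_, ?_, ?_, ?_, ?_, ?_⟩ <;> (try simp only) <;> linarith
    exact disjoint_left.1 K.disjoint_cut1_cut3 ⟨hC, hplane1 _ (by ring)⟩
      ⟨hC, hplane3 _ (by ring)⟩
  · ext y
    obtain ⟨p, rfl⟩ := ψ.surjective y
    rw [ψ.injective.mem_set_image, Equitruncation.solid, mem_inter_iff, hmem, hcut4]
    obtain ⟨x, s, t⟩ := p
    simp only [CutOffsets.mem_model]
    constructor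
    · rintro ⟨⟨h1, h2, h3, h4, h5, h6, h7, h8, h9, h10, h11, h12⟩, k⟩
      exact ⟨h1, h2, h3, h4, h5, h6, h7, h8, h9, h10, h11, k⟩
    · rintro ⟨h1, h2, h3, h4, h5, h6, h7, h8, h9, h10, h11, h12⟩
      exact ⟨⟨h1, h2, h3, h4, h5, h6, h7, h8, h9, h10, h11, by linarith⟩, h12⟩

end TriangularCupola

theorem mainTheorem4 (C : TriangularCupola) (K : C.Equitruncation) :
    IsEquiprojective 11 K.solid := by
  obtain ⟨ψ, Q, hQ, h⟩ := K.exists_offsets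
  rw [h]
  exact hQ.isEquiprojective_image ψ
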